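/- Consider a (possibly infinite) set $S$ of stations and a finite set $Z$ of vehicle trips. A trip $z$ serves stations $s_{z,0},\dots,s_{z,n_z}$; on leg $k\in\{0,\dots,n_z-1\}$ it departs from $s_{z,k}$ at time $d_{z,k}\in\mathbb R$ and arrives at $s_{z,k+1}$ at time $a_{z,k}>d_{z,k}$, where $a_{z,k}\le d_{z,k+1}$ for $k+1<n_z$, and it has a capacity $\nu_z\ge 0$. The time-expanded graph $G=(V,E)$ has an on-platform node $(s,t)$ for every station $s$ and time $t$ at which some vehicle departs from or arrives at $s$, and a departure node $D_{z,k}$ (of time $d_{z,k}$) and an arrival node $A_{z,k}$ (of time $a_{z,k}$) for every leg; write $\theta(v)$ for the time of a node $v$. Its edges are: waiting edges between time-consecutive on-platform nodes of the same station, boarding edges $b_{z,k}=((s_{z,k},d_{z,k}),D_{z,k})$, driving edges $b_{z,k}^+=(D_{z,k},A_{z,k})$ of capacity $\nu_z$, alighting edges $(A_{z,k},(s_{z,k+1},a_{z,k}))$, and dwelling edges $(A_{z,k},D_{z,k+1})$ for $k+1<n_z$. Let $I$ be a finite set of commodities. Commodity $i$ has an origin $s_i$ and a destination $t_i$ in $S$,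 an interval $\Theta_i\subseteq\mathbb R$ of feasible departure times, a target arrival time $T_i\in\mathbb R$, penalty factors $\beta_i,\gamma_i^+,\gamma_i^-\ge0$, a demand $Q_i\ge0$, and an outside option of constant cost $\pi_{\varnothing_i}\in\mathbb R$ (elastic demand is modelled by splitting the agents into commodities with a common willingness to travel, expressed by the outside option). Its strategy set $\mathcal P_i$ consists of the outside option $\varnothing_i$, which uses no edges, and of all directed paths $p$ in $G$ from an on-platform node $v$ of $s_i$ with $\theta(v)\in\Theta_i$ to an on-platform node $w$ of $t_i$. With $\mathrm{arr}_p=\theta(w)$ and $\tau_p=\theta(w)-\theta(v)$, such a path has the cost \[\pi_{i,p}=\beta_i\tau_p+\gamma_i^+\max\{0,\mathrm{arr}_p-T_i\}+\gamma_i^-\max\{0,T_i-\mathrm{arr}_p\},\] and $\pi_{i,\varnothing_i}=\pi_{\varnothing_i}$. A flow is a vector $f=(f_{i,p})_{i\in I,\,p\in\mathcal P_i}$ of nonnegative reals; $f_e=\sum_{i,\,p:\,e\in p}f_{i,p}$ is its value on the edge $e$. It is feasible if $\sum_{p\in\mathcal P_i}f_{i,p}=Q_i$ for all $i$ and $f_e\le\nu_z$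 for every driving edge $e$ of every trip $z$. For $p,q\in\mathcal P_i$ and $0<\varepsilon\le f_{i,p}$ let $f_{i,p\to q}(\varepsilon)=f+\varepsilon(1_{i,q}-1_{i,p})$; this deviation is admissible if $(f_{i,p\to q}(\varepsilon))_{e^+}\le\nu_z$ for every boarding edge $e=b_{z,k}$ of $q$. The strategy $q$ is an available alternative to $p$ for $i$ given $f$ if $f_{i,p\to q}(\varepsilon)$ is admissible for some $\varepsilon\in(0,f_{i,p}]$. A feasible flow $f$ is a (side-constrained) user equilibrium if for all $i\in I$ and $p\in\mathcal P_i$ with $f_{i,p}>0$ one has $\pi_{i,p}\le\pi_{i,q}$ for every available alternative $q$ to $p$ for $i$ given $f$. Theorem. If the instance has fixed departure times, i.e. $\Theta_i$ is a singleton for every $i\in I$, then a side-constrained user equilibrium exists. -/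

import Mathlib

/-- A timetable for the vehicle trips `Z` on the stations `S`. Trip `z` serves the stations
`station z 0, …, station z (legs z)`; on its `k`-th leg it leaves `station z k` at time `dep z k` and
arrives at `station z (k+1)` at time `arr z k`. -/
structure TransitNetwork (S Z : Type*) where
  legs : Z → ℕ
  station : (z : Z) → Fin (legs z + 1) → S
  dep : (z : Z) → Fin (legs z) → ℝ
  arr : (z : Z) → Fin (legs z) → ℝ
  dep_lt_arr : ∀ (z : Z) (k : Fin (legs z)), dep z k < arr z k
  arr_le_dep : ∀ (z : Z) (k : ℕ) (hk : k + 1 < legs z),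
    arr z ⟨k, Nat.lt_of_succ_lt hk⟩ ≤ dep z ⟨k + 1, hk⟩
  /-- The vehicle capacity `ν_z`. -/
  capacity : Z → ℝ
  capacity_nonneg : ∀ z, 0 ≤ capacity z

namespace TransitNetwork

variable {S Z I : Type*}

/-- The pairs (station, time) at which some vehicle departs or arrives. -/
def events (N : TransitNetwork S Z) : Set (S × ℝ) :=
  Set.range (fun x : (z : Z) × Fin (N.legs z) => (N.station x.1 x.2.castSucc, N.dep x.1 x.2)) ∪
  Set.range (fun x : (z : Z) × Fin (N.legs z) => (N.station x.1 x.2.succ, N.arr x.1 x.2))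

theorem dep_mem_events (N : TransitNetwork S Z) (z : Z) (k : Fin (N.legs z)) :
    (N.station z k.castSucc, N.dep z k) ∈ N.events := Or.inl ⟨⟨z, k⟩, rfl⟩

theorem arr_mem_events (N : TransitNetwork S Z) (z : Z) (k : Fin (N.legs z)) :
    (N.station z k.succ, N.arr z k) ∈ N.events := Or.inr ⟨⟨z, k⟩, rfl⟩

/-- Nodes of the time-expanded graph. The departure node `departure z k` belongs to the
departure of `z` from its stop `k`, the arrival node `arrival z k` to its arrival at stop `k+1`. -/
inductive Node (N : TransitNetwork S Z) where
  | platform (s : S) (t : ℝ) (h : (s, t) ∈ N.events)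
  | departure (z : Z) (k : Fin (N.legs z))
  | arrival (z : Z) (k : Fin (N.legs z))

/-- The time `θ(v)` of a node. -/
def Node.time {N : TransitNetwork S Z} : N.Node → ℝ
  | .platform _ t _ => t
  | .departure z k => N.dep z k
  | .arrival z k => N.arr z k

/-- Edges of the time-expanded graph. A waiting edge joins two consecutive on-platform nodes of
a station; a dwelling edge exists at every stop where the vehicle arrives and departs again. -/
inductive Edge (N : TransitNetwork S Z) where
  | waiting (s : S) (t t' : ℝ) (h : (s, t) ∈ N.events) (h' : (s, t') ∈ N.events) (hlt : t < t')
      (hcons : ∀ u, (s, u) ∈ N.events → ¬ (t < u ∧ u < t'))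
  | boarding (z : Z) (k : Fin (N.legs z))
  | driving (z : Z) (k : Fin (N.legs z))
  | alighting (z : Z) (k : Fin (N.legs z))
  | dwelling (z : Z) (k : ℕ) (hk : k + 1 < N.legs z)

namespace Edge

variable {N : TransitNetwork S Z}

/-- The tail of an edge. -/
def src : N.Edge → N.Node
  | waiting s t _ h _ _ _ => .platform s t h
  | boarding z k => .platform (N.station z k.castSucc) (N.dep z k) (N.dep_mem_events z k)
  | driving z k => .departure z k
  | alighting z k => .arrival z k
  | dwelling z k hk => .arrival z ⟨k, Nat.lt_of_succ_lt hk⟩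

/-- The head of an edge. -/
def tgt : N.Edge → N.Node
  | waiting s _ t' _ h' _ _ => .platform s t' h'
  | boarding z k => .departure z k
  | driving z k => .arrival z k
  | alighting z k => .platform (N.station z k.succ) (N.arr z k) (N.arr_mem_events z k)
  | dwelling z k hk => .departure z ⟨k + 1, hk⟩

/-- The traversal time `τ_e`. -/
def traversalTime (e : N.Edge) : ℝ := e.tgt.time - e.src.time

end Edge

/-- `IsWalk v l w`: the edges of `l`, traversed in this order, lead from `v` to `w`. -/
def IsWalk {N : TransitNetwork S Z} : N.Node → List N.Edge → N.Node → Prop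
  | v, [], w => v = w
  | v, e :: l, w => e.src = v ∧ IsWalk e.tgt l w

/-- A directed path in the time-expanded graph (no node is visited twice). -/
@[ext]
structure Path (N : TransitNetwork S Z) where
  start : N.Node
  finish : N.Node
  edges : List N.Edge
  isWalk : IsWalk start edges finish
  nodup : (start :: edges.map Edge.tgt).Nodup

/-- The traversal time `τ_p`. -/
def Path.traversalTime {N : TransitNetwork S Z} (p : N.Path) : ℝ :=
  (p.edges.map Edge.traversalTime).sum

/-- The arrival time `arr_p`. -/
def Path.arrivalTime {N : TransitNetwork S Z} (p : N.Path) : ℝ := p.finish.time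

section Finiteness

variable (N : TransitNetwork S Z)

instance [Finite Z] : Finite N.events :=
  ((Set.finite_range _).union (Set.finite_range _)).to_subtype

instance [Finite Z] : Finite N.Node := by
  let g : N.events ⊕ ((z : Z) × Fin (N.legs z)) ⊕ ((z : Z) × Fin (N.legs z)) → N.Node :=
    Sum.elim (fun x => .platform x.1.1 x.1.2 x.2)
      (Sum.elim (fun x => .departure x.1 x.2) (fun x => .arrival x.1 x.2))
  refine Finite.of_surjective g ?_
  rintro (⟨s, t, h⟩ | ⟨z, k⟩ | ⟨z, k⟩)
  · exact ⟨.inl ⟨(s, t), h⟩, rfl⟩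
  · exact ⟨.inr (.inl ⟨z, k⟩), rfl⟩
  · exact ⟨.inr (.inr ⟨z, k⟩), rfl⟩

instance [Finite Z] : Finite N.Edge := by
  refine Finite.of_injective (fun e : N.Edge => (e.src, e.tgt)) ?_
  rintro (_ | _ | _ | _ | _) (_ | _ | _ | _ | _) h <;>
    simp only [Edge.src, Edge.tgt, Prod.mk.injEq, Node.platform.injEq, Node.departure.injEq,
      Node.arrival.injEq, reduceCtorEq, and_false, false_and] at h
  · obtain ⟨⟨rfl, rfl⟩, -, rfl⟩ := h; rfl
  · obtain ⟨-, rfl, h⟩ := h; cases h; rfl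
  · obtain ⟨⟨rfl, h⟩, -⟩ := h; cases h; rfl
  · obtain ⟨⟨rfl, h⟩, -⟩ := h; cases h; rfl
  · obtain ⟨⟨rfl, h⟩, -⟩ := h; simp at h; subst h; rfl

instance [Finite Z] : Finite N.Path := by
  classical
  have := Fintype.ofFinite N.Edge
  refine Finite.of_injective
    (β := N.Node × N.Node × {l : List N.Edge // l.Nodup})
    (fun p => (p.start, p.finish, ⟨p.edges, (List.nodup_cons.1 p.nodup).2.of_map _⟩)) ?_
  intro p q h
  simp only [Prod.mk.injEq, Subtype.mk.injEq] at h
  exact Path.ext h.1 h.2.1 h.2.2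

end Finiteness

/-- A commodity of non-atomic agents. -/
structure Commodity (S : Type*) where
  origin : S
  destination : S
  /-- The interval `Θ` of feasible departure times. -/
  departureTimes : Set ℝ
  ordConnected : departureTimes.OrdConnected
  /-- The target arrival time `T`. -/
  target : ℝ
  /-- Penalty factors of the travel time, of late arrival and of early arrival. -/
  β : ℝ
  γLate : ℝ
  γEarly : ℝ
  β_nonneg : 0 ≤ β
  γLate_nonneg : 0 ≤ γLate
  γEarly_nonneg : 0 ≤ γEarly
  /-- The demand volume `Q`. -/
  demand : ℝ
  demand_nonneg : 0 ≤ demand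
  /-- The cost of the outside option. -/
  outsideCost : ℝ

variable (N : TransitNetwork S Z)

/-- The paths that start during `Θ` at an on-platform node of the origin and end at an
on-platform node of the destination. -/
def CommodityPath (c : Commodity S) : Type _ :=
  {p : N.Path // (∃ t h, p.start = .platform c.origin t h ∧ t ∈ c.departureTimes) ∧
    ∃ t h, p.finish = .platform c.destination t h}

instance [Finite Z] (c : Commodity S) : Finite (N.CommodityPath c) :=
  inferInstanceAs (Finite {_p : N.Path // _})

noncomputable instance [Finite Z] (c : Commodity S) : Fintype (N.CommodityPath c) :=
  Fintype.ofFinite _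

/-- The strategy set of a commodity; `none` is the outside option. -/
abbrev Strategy (c : Commodity S) : Type _ := Option (N.CommodityPath c)

variable {N}

/-- The edges used by a strategy. -/
def Strategy.edges {c : Commodity S} : N.Strategy c → List N.Edge
  | none => []
  | some p => p.1.edges

/-- The experienced cost `π_{i,p}` of a strategy. -/
noncomputable def Strategy.cost {c : Commodity S} : N.Strategy c → ℝ
  | none => c.outsideCost
  | some p => c.β * p.1.traversalTime + c.γLate * max 0 (p.1.arrivalTime - c.target) +
      c.γEarly * max 0 (c.target - p.1.arrivalTime)

/-- The instance has fixed departure times: every `Θ_i` is a singleton. -/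
def FixedDepartureTimes (C : I → Commodity S) : Prop :=
  ∀ i, ∃ θ : ℝ, (C i).departureTimes = {θ}

variable (N) in
/-- Real vectors indexed by the commodity-strategy pairs. -/
abbrev FlowVector (C : I → Commodity S) : Type _ := (i : I) → N.Strategy (C i) → ℝ

namespace FlowVector

variable {C : I → Commodity S}

open Classical in
/-- The total flow `f_e` on an edge. -/
noncomputable def edgeFlow [Fintype I] [Finite Z] (f : N.FlowVector C) (e : N.Edge) : ℝ :=
  ∑ i, ∑ p : N.Strategy (C i), if e ∈ p.edges then f i p else 0

/-- All path flows are nonnegative and every commodity routes exactly its demand. -/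
def DemandFeasible [Finite Z] (f : N.FlowVector C) : Prop :=
  (∀ i p, 0 ≤ f i p) ∧ ∀ i, ∑ p : N.Strategy (C i), f i p = (C i).demand

/-- No driving edge carries more flow than the capacity of its vehicle. -/
def CapacityFeasible [Fintype I] [Finite Z] (f : N.FlowVector C) : Prop :=
  ∀ (z : Z) (k : Fin (N.legs z)), f.edgeFlow (.driving z k) ≤ N.capacity z

/-- A feasible flow. -/
def Feasible [Fintype I] [Finite Z] (f : N.FlowVector C) : Prop :=
  f.DemandFeasible ∧ f.CapacityFeasible

open Classical in
/-- The `ε`-deviation `f_{i,p→q}(ε) = f + ε (1_{i,q} - 1_{i,p})`. -/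
noncomputable def deviate (f : N.FlowVector C) (i : I) (p q : N.Strategy (C i)) (ε : ℝ) :
    N.FlowVector C :=
  f + ε • (Pi.single i (Pi.single q 1) - Pi.single i (Pi.single p 1))

/-- The deviation `f_{i,p→q}(ε)` is admissible: no boarding edge of `q` leads to a driving edge
that is overfilled after the deviation. -/
def AdmissibleDeviation [Fintype I] [Finite Z] (f : N.FlowVector C) (i : I)
    (p q : N.Strategy (C i)) (ε : ℝ) : Prop :=
  ∀ (z : Z) (k : Fin (N.legs z)), Edge.boarding z k ∈ q.edges →
    (f.deviate i p q ε).edgeFlow (.driving z k) ≤ N.capacity z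

/-- The available alternatives to `p` for commodity `i`; an `ε`-deviation from `p` requires
`ε ≤ f_{i,p}`. -/
def availableAlternatives [Fintype I] [Finite Z] (f : N.FlowVector C) (i : I)
    (p : N.Strategy (C i)) : Set (N.Strategy (C i)) :=
  {q | ∃ ε : ℝ, 0 < ε ∧ ε ≤ f i p ∧ f.AdmissibleDeviation i p q ε}

/-- Side-constrained user equilibria. -/
def IsUserEquilibrium [Fintype I] [Finite Z] (f : N.FlowVector C) : Prop :=
  f.Feasible ∧ ∀ (i : I) (p : N.Strategy (C i)), 0 < f i p →
    ∀ q ∈ f.availableAlternatives i p, p.cost ≤ q.cost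

end FlowVector

end TransitNetwork

/-!
Let every commodity rank its strategies by cost, and every leg the strategies that drive it, first
by how early they boarded the vehicle and then by cost. Scarf's lemma yields a feasible flow in
which every strategy is dominated: either no strategy in use by its commodity costs more, or it
drives a full leg that weakly prefers all its passengers. The lemma itself is proved by a parity
argument: modulo 2, the dominating sets together with the set of slack columns form a cycle, the
supports of the nonnegative solutions of a nondegenerate system form a cocycle, and a cycle and a
cocycle meet in an even number of sets; degenerate systems follow by a limit.

Such a flow is an equilibrium. Let `p` be in use by a commodity and `q` an available alternative to
`p`. Follow `p` up to the last leg driven by `p` that `q` boards, and `q` from there on; as the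
departure time is fixed, this strategy `r` costs as much as `q`. If `r` is dominated at a leg, all
passengers of that leg boarded no later than `r`, so they fill the leg at which `r` boarded and all
stay on board. A full leg leaves `q` no room to board where `p` does not drive, so `p` boards there
as well; hence `p` is one of the passengers weakly preferred to `r`. Having boarded no earlier than
`r`, it costs no more.
-/

section Parity

open Finset

variable {V : Type*} [DecidableEq V] {n : ℕ} {𝒟 ℱ : Finset (Finset V)}

theorem odd_card_filter_subset_iff (h𝒟 : (𝒟 : Set (Finset V)).Sized n) {F : Finset V}
    (hF : #F = n) : Odd #{D ∈ 𝒟 | F ⊆ D} ↔ F ∈ 𝒟 := by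
  have heq : ∀ D ∈ 𝒟, F ⊆ D ↔ F = D := fun D hD =>
    ⟨fun h => eq_of_subset_of_card_le h (by rw [h𝒟 hD, hF]), fun h => h.subset⟩
  rw [filter_congr heq, filter_eq]
  split_ifs with h <;> simp [h]

theorem odd_card_filter_subset_insert_iff (h𝒟 : (𝒟 : Set (Finset V)).Sized n)
    (hcycle : ∀ K : Finset V, #K + 1 = n → Even #{D ∈ 𝒟 | K ⊆ D}) {F : Finset V} (hF : #F = n)
    (v : V) : Odd #{D ∈ 𝒟 | v ∉ D ∧ F ⊆ insert v D} ↔ F ∈ 𝒟 := by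
  rw [← odd_card_filter_subset_iff h𝒟 hF]
  by_cases hv : v ∈ F
  · have hsplit : #{D ∈ 𝒟 | F ⊆ D} + #{D ∈ 𝒟 | v ∉ D ∧ F ⊆ insert v D} =
        #{D ∈ 𝒟 | F.erase v ⊆ D} := by
      rw [← card_filter_add_card_filter_not (s := {D ∈ 𝒟 | F.erase v ⊆ D}) (v ∈ ·),
        filter_filter, filter_filter]
      congr 2 <;> refine filter_congr fun D _ => ?_
      · rw [and_comm, ← insert_subset_iff, insert_erase hv]
      · rw [subset_insert_iff, and_comm]
    have heven := hcycle (F.erase v) (by rw [card_erase_add_one hv, hF])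
    rw [← hsplit, Nat.even_add'] at heven
    exact heven.symm
  · have hfilter : ∀ D ∈ 𝒟, v ∉ D ∧ F ⊆ insert v D ↔ F ⊆ D := fun D hD => by
      rw [subset_insert_iff_of_notMem hv, and_iff_right_iff_imp]
      intro h
      rwa [← eq_of_subset_of_card_le h (by rw [h𝒟 hD, hF])]
    rw [filter_congr hfilter]

-- The cone over `𝒟` with apex `v` is a chain with boundary `𝒟`, on which the cocycle `ℱ` vanishes.
theorem even_card_inter_of_cycle_of_cocycle (h𝒟 : (𝒟 : Set (Finset V)).Sized n)
    (hℱ : (ℱ : Set (Finset V)).Sized n)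
    (hcycle : ∀ K : Finset V, #K + 1 = n → Even #{D ∈ 𝒟 | K ⊆ D})
    (hcocycle : ∀ M : Finset V, #M = n + 1 → Even #{F ∈ ℱ | F ⊆ M}) (v : V) :
    Even #(𝒟 ∩ ℱ) := by
  have hcone : Even (∑ D ∈ 𝒟 with v ∉ D, #{F ∈ ℱ | F ⊆ insert v D}) := by
    refine Finset.even_sum _ fun D hD => hcocycle _ ?_
    obtain ⟨hD, hvD⟩ := mem_filter.1 hD
    rw [card_insert_of_notMem hvD, h𝒟 hD]
  have hswap : ∑ D ∈ 𝒟 with v ∉ D, #{F ∈ ℱ | F ⊆ insert v D} =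
      ∑ F ∈ ℱ, #{D ∈ 𝒟 | v ∉ D ∧ F ⊆ insert v D} := by
    simp only [← filter_filter]
    exact sum_card_bipartiteAbove_eq_sum_card_bipartiteBelow fun (D F : Finset V) => F ⊆ insert v D
  have hodd : {F ∈ ℱ | Odd #{D ∈ 𝒟 | v ∉ D ∧ F ⊆ insert v D}} = 𝒟 ∩ ℱ := by
    rw [filter_congr fun F hF => odd_card_filter_subset_insert_iff h𝒟 hcycle (hℱ hF) v,
      filter_mem_eq_inter, inter_comm]
  rwa [hswap, ← Nat.not_odd_iff_even, odd_sum_iff_odd_card_odd, hodd, Nat.not_odd_iff_even]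
    at hcone

end Parity

section Dominating

open Finset

variable {R V L : Type*}

/-- A set `D` of columns is dominating for the row orders `c`, in the sense of Scarf, if every
column lies, in some row, weakly below all columns of `D`. -/
def IsDominating [LE L] (c : R → V → L) (D : Finset V) : Prop :=
  ∀ v, ∃ i, ∀ d ∈ D, c i v ≤ c i d

/-- The column `k` is the minimum of the set `K` in row `i`. -/
def IsRowMin [LE L] (c : R → V → L) (K : Finset V) (i : R) (k : V) : Prop :=
  k ∈ K ∧ ∀ k' ∈ K, c i k ≤ c i k'

/-- The columns that can be added to `K` so that the minimum of `K` changes at most in row `i`. -/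
def pivotCandidates [LT L] (c : R → V → L) (K : Finset V) (i : R) : Set V :=
  {v | ∀ l ≠ i, ∃ k ∈ K, c l k < c l v}

/-- The column `v` is the largest pivot candidate of `K` in row `i`; these columns are the ones
that complete `K` to a dominating set. -/
def IsPivot [LinearOrder L] (c : R → V → L) (K : Finset V) (i : R) (v : V) : Prop :=
  v ∈ pivotCandidates c K i ∧ ∀ w ∈ pivotCandidates c K i, c i w ≤ c i v

variable [LinearOrder L] {c : R → V → L} {D K : Finset V} {i a b : R} {v w k : V}

theorem IsDominating.subset (hD : IsDominating c D) (hKD : K ⊆ D) : IsDominating c K := fun v =>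
  (hD v).imp fun _ hi k hk => hi k (hKD hk)

theorem IsRowMin.eq (hc : Function.Injective (c i)) (hv : IsRowMin c K i v)
    (hw : IsRowMin c K i w) : v = w :=
  hc (le_antisymm (hv.2 w hw.1) (hw.2 v hv.1))

theorem IsPivot.eq (hc : Function.Injective (c i)) (hv : IsPivot c K i v) (hw : IsPivot c K i w) :
    v = w :=
  hc (le_antisymm (hw.2 v hv.1) (hv.2 w hw.1))

theorem exists_isPivot [Finite V] (h : (pivotCandidates c K i).Nonempty) :
    ∃ v, IsPivot c K i v :=
  Set.exists_max_image _ (c i) (Set.toFinite _) h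

theorem IsDominating.le_of_mem_pivotCandidates (hK : IsDominating c K)
    (hv : v ∈ pivotCandidates c K i) : ∀ k ∈ K, c i v ≤ c i k := by
  obtain ⟨l, hl⟩ := hK v
  rcases eq_or_ne l i with rfl | hli
  · exact hl
  · obtain ⟨k, hk, hlt⟩ := hv l hli
    exact absurd (hl k hk) hlt.not_ge

theorem IsDominating.disjoint_pivotCandidates (hK : IsDominating c K) (hab : a ≠ b) :
    Disjoint (pivotCandidates c K a) (pivotCandidates c K b) := by
  refine Set.disjoint_left.2 fun v hva hvb => ?_
  obtain ⟨k, hk, hlt⟩ := hvb a hab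
  exact (hK.le_of_mem_pivotCandidates hva k hk).not_gt hlt

theorem IsDominating.notMem_of_mem_pivotCandidates (hc : Function.Injective (c a))
    (hK : IsDominating c K) (hab : a ≠ b) (ha : IsRowMin c K a k) (hb : IsRowMin c K b k)
    (hv : v ∈ pivotCandidates c K a) : v ∉ K := fun hvK => by
  obtain rfl : v = k := ha.eq hc ⟨hvK, hK.le_of_mem_pivotCandidates hv⟩ |>.symm
  obtain ⟨k', hk', hlt⟩ := hv b hab.symm
  exact (hb.2 k' hk').not_gt hlt

theorem IsDominating.exists_bijOn_isRowMin [Fintype R] (hc : ∀ i, Function.Injective (c i))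
    (hD : IsDominating c D) (hcard : #D = Fintype.card R) :
    ∃ r : V → R, Set.BijOn r D Set.univ ∧ ∀ v, ∀ d ∈ D, c (r v) v ≤ c (r v) d := by
  classical
  choose r hr using hD
  have hinj : Set.InjOn r D := fun d hd d' hd' h =>
    hc (r d) (le_antisymm (hr d d' hd') (h ▸ hr d' d hd))
  have himage : D.image r = univ :=
    (card_eq_iff_eq_univ _).1 ((card_image_of_injOn hinj).trans hcard)
  refine ⟨r, ⟨Set.mapsTo_univ _ _, hinj, fun i _ => ?_⟩, hr⟩
  simpa using (himage ▸ mem_univ i : i ∈ D.image r)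

theorem exists_ne_isRowMin [Fintype R] (hcard : #K < Fintype.card R) (hK : K.Nonempty) :
    ∃ a b k, a ≠ b ∧ IsRowMin c K a k ∧ IsRowMin c K b k := by
  choose m hm using fun i => K.exists_min_image (c i) hK
  obtain ⟨a, -, b, -, hab, hmab⟩ := exists_ne_map_eq_of_card_lt_of_maps_to
    (s := univ) (t := K) (f := m) (by rwa [card_univ]) fun i _ => (hm i).1
  exact ⟨a, b, m a, hab, hm a, hmab ▸ hm b⟩

open Classical in
/-- The dominating sets with as many columns as there are rows. -/
noncomputable def dominatingSets [Fintype R] [Fintype V] (c : R → V → L) : Finset (Finset V) :=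
  {D | #D = Fintype.card R ∧ IsDominating c D}

theorem mem_dominatingSets [Fintype R] [Fintype V] :
    D ∈ dominatingSets c ↔ #D = Fintype.card R ∧ IsDominating c D := by
  simp [dominatingSets]

variable [DecidableEq V]

theorem IsPivot.isDominating_insert (hv : IsPivot c K i v) (hK : IsDominating c K) :
    IsDominating c (insert v K) := by
  intro w
  simp only [forall_mem_insert]
  by_cases hw : w ∈ pivotCandidates c K i
  · exact ⟨i, hv.2 w hw, hK.le_of_mem_pivotCandidates hw⟩
  · simp only [pivotCandidates, Set.mem_ofPred_eq, not_forall, not_exists, not_and, not_lt] at hw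
    obtain ⟨l, hli, hl⟩ := hw
    obtain ⟨k, hk, hlt⟩ := hv.1 l hli
    exact ⟨l, (hl k hk).trans hlt.le, hl⟩

theorem IsDominating.exists_isPivot_of_insert [Fintype R] (hc : ∀ i, Function.Injective (c i))
    (hD : IsDominating c (insert v K)) (hv : v ∉ K) (hcard : #K + 1 = Fintype.card R) :
    ∃ i, IsPivot c K i v ∧
      ∀ a b k, a ≠ i → b ≠ i → IsRowMin c K a k → IsRowMin c K b k → a = b := by
  obtain ⟨r, hbij, hr⟩ :=
    hD.exists_bijOn_isRowMin hc (by rw [card_insert_of_notMem hv, hcard])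
  have hrow : ∀ l ≠ r v, ∃ k, r k = l ∧ k ∈ K := fun l hl => by
    obtain ⟨k, hk, rfl⟩ := hbij.surjOn (Set.mem_univ l)
    exact ⟨k, rfl, (mem_insert.1 hk).resolve_left fun h => hl (h ▸ rfl)⟩
  have hminK : ∀ k ∈ K, IsRowMin c K (r k) k := fun k hk =>
    ⟨hk, fun k' hk' => hr k k' (mem_insert_of_mem hk')⟩
  refine ⟨r v, ⟨fun l hl => ?_, fun w hw => ?_⟩, fun a b k ha hb hka hkb => ?_⟩
  · obtain ⟨k, rfl, hk⟩ := hrow l hl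
    exact ⟨k, hk, (hr k v (mem_insert_self _ _)).lt_of_ne fun h => hv (hc _ h ▸ hk)⟩
  · by_cases hrw : r w = r v
    · exact hrw ▸ hr w v (mem_insert_self _ _)
    · obtain ⟨k, hk, hlt⟩ := hw _ hrw
      exact absurd (hr w k (mem_insert_of_mem hk)) hlt.not_ge
  · obtain ⟨ka, rfl, hkaK⟩ := hrow a ha
    obtain ⟨kb, rfl, hkbK⟩ := hrow b hb
    rw [(hminK ka hkaK).eq (hc _) hka, (hminK kb hkbK).eq (hc _) hkb]

variable [Fintype R] [Fintype V]

theorem mem_filter_subset_dominatingSets (hcard : #K + 1 = Fintype.card R) :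
    D ∈ {D ∈ dominatingSets c | K ⊆ D} ↔ ∃ v ∉ K, insert v K = D ∧ IsDominating c D := by
  rw [mem_filter, mem_dominatingSets]
  constructor
  · rintro ⟨⟨hD, hdom⟩, hKD⟩
    obtain ⟨v, hv, rfl⟩ := exists_eq_insert_iff.2 ⟨hKD, hcard.trans hD.symm⟩
    exact ⟨v, hv, rfl, hdom⟩
  · rintro ⟨v, hv, rfl, hdom⟩
    exact ⟨⟨by rw [card_insert_of_notMem hv, hcard], hdom⟩, subset_insert v K⟩

theorem IsDominating.card_filter_subset_dominatingSets (hc : ∀ i, Function.Injective (c i))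
    (hK : IsDominating c K) (hcard : #K + 1 = Fintype.card R) (hne : K.Nonempty)
    (hcand : ∀ i, (pivotCandidates c K i).Nonempty) : #{D ∈ dominatingSets c | K ⊆ D} = 2 := by
  obtain ⟨a, b, k, hab, hka, hkb⟩ := exists_ne_isRowMin (c := c) (by omega) hne
  obtain ⟨va, hva⟩ := exists_isPivot (hcand a)
  obtain ⟨vb, hvb⟩ := exists_isPivot (hcand b)
  have hvaK : va ∉ K := hK.notMem_of_mem_pivotCandidates (hc a) hab hka hkb hva.1
  have hvbK : vb ∉ K := hK.notMem_of_mem_pivotCandidates (hc b) hab.symm hkb hka hvb.1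
  have hvab : va ≠ vb := (hK.disjoint_pivotCandidates hab).ne_of_mem hva.1 hvb.1
  refine card_eq_two.2 ⟨insert va K, insert vb K, fun h => hvab (insert_inj hvaK |>.1 h), ?_⟩
  ext D
  rw [mem_filter_subset_dominatingSets hcard, mem_insert, mem_singleton]
  constructor
  · rintro ⟨v, hv, rfl, hdom⟩
    obtain ⟨i, hpivot, hmin⟩ := hdom.exists_isPivot_of_insert hc hv hcard
    rcases eq_or_ne a i with rfl | hai
    · exact Or.inl (hpivot.eq (hc a) hva ▸ rfl)
    rcases eq_or_ne b i with rfl | hbi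
    · exact Or.inr (hpivot.eq (hc b) hvb ▸ rfl)
    · exact absurd (hmin a b k hai hbi hka hkb) hab
  · rintro (rfl | rfl)
    · exact ⟨va, hvaK, rfl, hva.isDominating_insert hK⟩
    · exact ⟨vb, hvbK, rfl, hvb.isDominating_insert hK⟩

end Dominating

section ScarfOrder

open Finset

variable {R X L : Type*} [LinearOrder L]

/-- The row orders of Scarf's lemma: the slack column of row `i` is the least in row `i`, and in
every other row it is above all proper columns. -/
structure IsScarfOrder (c : R → R ⊕ X → L) : Prop where
  slack_lt : ∀ i v, v ≠ Sum.inl i → c i (Sum.inl i) < c i v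
  lt_slack : ∀ i j x, j ≠ i → c i (Sum.inr x) < c i (Sum.inl j)

/-- The set of all slack columns, the one member of the cycle of Scarf's lemma that is not
dominating. -/
def slackColumns (R X : Type*) [Fintype R] : Finset (R ⊕ X) :=
  univ.map Function.Embedding.inl

variable {c : R → R ⊕ X → L}

theorem IsScarfOrder.slack_le (hc : IsScarfOrder c) (i : R) (v : R ⊕ X) :
    c i (Sum.inl i) ≤ c i v := by
  rcases eq_or_ne v (Sum.inl i) with rfl | hv
  exacts [le_rfl, (hc.slack_lt i v hv).le]

theorem IsScarfOrder.slack_notMem (hc : IsScarfOrder c) {D : Finset (R ⊕ X)} {i : R} {x : X}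
    (h : ∀ d ∈ D, c i (Sum.inr x) ≤ c i d) : Sum.inl i ∉ D := fun hi =>
  (h _ hi).not_gt (hc.slack_lt i _ Sum.inr_ne_inl)

theorem IsScarfOrder.slack_mem_pivotCandidates (hc : IsScarfOrder c) {K : Finset (R ⊕ X)} {y : X}
    (hy : Sum.inr y ∈ K) (i : R) : Sum.inl i ∈ pivotCandidates c K i := fun l hl =>
  ⟨_, hy, hc.lt_slack l i y hl.symm⟩

variable [Fintype R]

theorem inl_mem_slackColumns (i : R) : Sum.inl i ∈ slackColumns R X := by
  simp [slackColumns]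

theorem inr_notMem_slackColumns (x : X) : Sum.inr x ∉ slackColumns R X := by
  simp [slackColumns]

theorem card_slackColumns : #(slackColumns R X) = Fintype.card R := by
  simp [slackColumns]

theorem IsScarfOrder.not_isDominating_slackColumns [Nonempty X] (hc : IsScarfOrder c) :
    ¬ IsDominating c (slackColumns R X) := fun h =>
  have ⟨i, hi⟩ := h (Sum.inr (Classical.arbitrary X))
  hc.slack_notMem hi (inl_mem_slackColumns i)

variable [DecidableEq R] [DecidableEq X]

theorem IsScarfOrder.isDominating_slackColumns_erase (hc : IsScarfOrder c) (a : R) :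
    IsDominating c ((slackColumns R X).erase (Sum.inl a)) := by
  rintro (i | x)
  · exact ⟨i, fun d _ => hc.slack_le i d⟩
  · refine ⟨a, ?_⟩
    rintro (j | y) hd
    · exact (hc.lt_slack a j x fun h => ne_of_mem_erase hd (h ▸ rfl)).le
    · exact absurd (mem_of_mem_erase hd) (inr_notMem_slackColumns y)

theorem IsScarfOrder.inr_mem_pivotCandidates_iff (hc : IsScarfOrder c) {a i : R} {x : X} :
    Sum.inr x ∈ pivotCandidates c ((slackColumns R X).erase (Sum.inl a)) i ↔ i = a := by
  constructor
  · intro h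
    by_contra hia
    obtain ⟨j | y, hk, hlt⟩ := h a (Ne.symm hia)
    · exact (hc.lt_slack a j x fun h => ne_of_mem_erase hk (h ▸ rfl)).not_gt hlt
    · exact inr_notMem_slackColumns y (mem_of_mem_erase hk)
  · rintro rfl l hl
    exact ⟨Sum.inl l, mem_erase.2 ⟨fun h => hl (Sum.inl_injective h), inl_mem_slackColumns l⟩,
      hc.slack_lt l _ Sum.inr_ne_inl⟩

theorem IsScarfOrder.notMem_of_mem_pivotCandidates (hc : IsScarfOrder c) {a : R} {v : R ⊕ X}
    (hv : v ∈ pivotCandidates c ((slackColumns R X).erase (Sum.inl a)) a) :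
    v ∉ (slackColumns R X).erase (Sum.inl a) := by
  rw [mem_erase, not_and']
  rintro hmem hva
  obtain ⟨j, -, rfl⟩ := mem_map.1 hmem
  obtain ⟨k, -, hlt⟩ := hv j fun h => hva (h ▸ rfl)
  exact (hc.slack_le j k).not_gt hlt

variable [Fintype X]

theorem IsScarfOrder.card_filter_slackColumns_erase_subset [Nonempty X] (hc : IsScarfOrder c)
    (hinj : ∀ i, Function.Injective (c i)) (a : R) :
    #{D ∈ dominatingSets c | (slackColumns R X).erase (Sum.inl a) ⊆ D} = 1 := by
  set K := (slackColumns R X).erase (Sum.inl a)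
  have hcard : #K + 1 = Fintype.card R := by
    rw [card_erase_add_one (inl_mem_slackColumns a), card_slackColumns]
  obtain ⟨v, hv⟩ := exists_isPivot
    ⟨Sum.inr (Classical.arbitrary X), hc.inr_mem_pivotCandidates_iff.2 (rfl : a = a)⟩
  refine card_eq_one.2 ⟨insert v K, ?_⟩
  ext D
  rw [mem_filter_subset_dominatingSets hcard, mem_singleton]
  constructor
  · rintro ⟨w, hw, rfl, hdom⟩
    obtain ⟨i, hpivot, -⟩ := hdom.exists_isPivot_of_insert hinj hw hcard
    suffices i = a by
      subst this
      rw [hpivot.eq (hinj i) hv]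
    rcases w with j | x
    · obtain rfl : j = a := by simpa [K, inl_mem_slackColumns] using hw
      by_contra hij
      obtain ⟨k, -, hlt⟩ := hpivot.1 j (Ne.symm hij)
      exact (hc.slack_le j k).not_gt hlt
    · exact hc.inr_mem_pivotCandidates_iff.1 hpivot.1
  · rintro rfl
    exact ⟨v, hc.notMem_of_mem_pivotCandidates hv.1, rfl,
      hv.isDominating_insert (hc.isDominating_slackColumns_erase a)⟩

theorem IsScarfOrder.even_card_filter_subset_dominatingSets (hc : IsScarfOrder c)
    (hinj : ∀ i, Function.Injective (c i)) {K : Finset (R ⊕ X)} (hK : #K + 1 = Fintype.card R)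
    {y : X} (hy : Sum.inr y ∈ K) : Even #{D ∈ dominatingSets c | K ⊆ D} := by
  by_cases hdom : IsDominating c K
  · rw [hdom.card_filter_subset_dominatingSets hinj hK ⟨_, hy⟩ fun i =>
      ⟨_, hc.slack_mem_pivotCandidates hy i⟩]
    exact even_two
  · rw [filter_false_of_mem fun D hD hKD => hdom ((mem_dominatingSets.1 hD).2.subset hKD)]
    exact Even.zero

theorem IsScarfOrder.even_card_filter_subset_insert_slackColumns [Nonempty X]
    (hc : IsScarfOrder c) (hinj : ∀ i, Function.Injective (c i)) {K : Finset (R ⊕ X)}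
    (hK : #K + 1 = Fintype.card R) :
    Even #{D ∈ insert (slackColumns R X) (dominatingSets c) | K ⊆ D} := by
  have hslack : slackColumns R X ∉ {D ∈ dominatingSets c | K ⊆ D} := fun h =>
    hc.not_isDominating_slackColumns (mem_dominatingSets.1 (mem_of_mem_filter _ h)).2
  rw [filter_insert]
  by_cases hKs : K ⊆ slackColumns R X
  · rw [if_pos hKs, card_insert_of_notMem hslack]
    obtain ⟨v, hv, hvK⟩ := exists_eq_insert_iff.2 ⟨hKs, hK.trans card_slackColumns.symm⟩
    obtain ⟨a, -, rfl⟩ := mem_map.1 (hvK ▸ mem_insert_self v K)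
    rw [← erase_insert hv, hvK]
    exact (hc.card_filter_slackColumns_erase_subset hinj a).symm ▸ even_two
  · rw [if_neg hKs]
    obtain ⟨i | y, hkK, hk⟩ := not_subset.1 hKs
    · exact absurd (inl_mem_slackColumns i) hk
    · exact hc.even_card_filter_subset_dominatingSets hinj hK hkK

end ScarfOrder

section TieBreaking

variable {R V X L : Type*} [Fintype V]

/-- The row orders `c` with ties broken by an enumeration of the columns. -/
noncomputable def breakTies (c : R → V → L) (i : R) (v : V) : L ×ₗ Fin (Fintype.card V) :=
  toLex (c i v, Fintype.equivFin V v)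

theorem injective_breakTies (c : R → V → L) (i : R) : Function.Injective (breakTies c i) :=
  fun _ _ h => (Fintype.equivFin V).injective (congrArg Prod.snd (toLex.injective h))

variable [LinearOrder L]

theorem IsDominating.of_breakTies {c : R → V → L} {D : Finset V}
    (hD : IsDominating (breakTies c) D) : IsDominating c D := fun v =>
  (hD v).imp fun _ hi d hd => Prod.Lex.monotone_fst _ _ (hi d hd)

theorem isScarfOrder_breakTies [Fintype R] [Fintype X] {c : R → R ⊕ X → L}
    (hc : IsScarfOrder c) : IsScarfOrder (breakTies c) where
  slack_lt i v hv := Prod.Lex.toLex_lt_toLex.2 (Or.inl (hc.slack_lt i v hv))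
  lt_slack i j x hj := Prod.Lex.toLex_lt_toLex.2 (Or.inl (hc.lt_slack i j x hj))

end TieBreaking

section FeasibleSupport

open Finset Module

variable {R V : Type*} [Fintype V] {B : Matrix R V ℝ} {b : R → ℝ} {F M : Finset V}
  {w x : V → ℝ}

/-- The nonnegative solutions `x` of the linear system `B x = b` supported on `F`. -/
structure IsSolutionOn (B : Matrix R V ℝ) (b : R → ℝ) (F : Finset V) (x : V → ℝ) : Prop where
  nonneg : 0 ≤ x
  mulVec_eq : B.mulVec x = b
  eq_zero_of_notMem : ∀ v ∉ F, x v = 0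

theorem IsSolutionOn.mono (hx : IsSolutionOn B b F x) (hFM : F ⊆ M) : IsSolutionOn B b M x :=
  ⟨hx.nonneg, hx.mulVec_eq, fun v hv => hx.eq_zero_of_notMem v fun h => hv (hFM h)⟩

theorem IsSolutionOn.exists_mem_ne_zero (hx : IsSolutionOn B b F x) {i : R} (hi : b i ≠ 0) :
    ∃ v ∈ F, B i v ≠ 0 := by
  rw [← hx.mulVec_eq] at hi
  obtain ⟨v, -, hv⟩ := exists_ne_zero_of_sum_ne_zero hi
  exact ⟨v, not_imp_comm.1 (hx.eq_zero_of_notMem v) (right_ne_zero_of_mul hv),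
    left_ne_zero_of_mul hv⟩

theorem eq_zero_of_nonneg_of_mulVec_eq_zero (hB : ∀ i v, 0 ≤ B i v)
    (hcol : ∀ v, ∃ i, 0 < B i v) (hw : 0 ≤ w) (h : B.mulVec w = 0) : w = 0 := by
  funext v
  obtain ⟨i, hi⟩ := hcol v
  have hsum : ∑ u, B i u * w u = 0 := congrFun h i
  have hv := (sum_eq_zero_iff_of_nonneg fun u _ => mul_nonneg (hB i u) (hw u)).1 hsum v
    (mem_univ v)
  exact (mul_eq_zero.1 hv).resolve_left hi.ne'

theorem exists_ne_zero_mulVec_eq_zero [Fintype R] (B : Matrix R V ℝ)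
    (hM : Fintype.card R < #M) :
    ∃ w ≠ 0, B.mulVec w = 0 ∧ ∀ v ∉ M, w v = 0 := by
  classical
  let extend : (M → ℝ) →ₗ[ℝ] V → ℝ := Function.ExtendByZero.linearMap ℝ ((↑) : M → V)
  have hker : LinearMap.ker (B.mulVecLin ∘ₗ extend) ≠ ⊥ :=
    LinearMap.ker_ne_bot_of_finrank_lt (by simpa using hM)
  obtain ⟨g, hg, hg0⟩ := Submodule.exists_mem_ne_zero_of_ne_bot hker
  refine ⟨extend g, fun h => hg0 ?_, hg, fun v hv => ?_⟩
  · exact Function.extend_injective Subtype.val_injective (0 : V → ℝ)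
      (h.trans (map_zero extend).symm)
  · exact Function.extend_apply' _ _ _ (by simpa using hv)

theorem IsSolutionOn.exists_erase [DecidableEq V] (hB : ∀ w, 0 ≤ w → B.mulVec w = 0 → w = 0)
    (hx : IsSolutionOn B b M x) (hw : B.mulVec w = 0) (hw0 : w ≠ 0) (hwM : ∀ v ∉ M, w v = 0) :
    ∃ v ∈ M, w v < 0 ∧ ∃ x', IsSolutionOn B b (M.erase v) x' := by
  have hneg : ({v | w v < 0} : Finset V).Nonempty := by
    by_contra h
    simp only [not_nonempty_iff_eq_empty, filter_eq_empty_iff, mem_univ, true_imp_iff, not_lt] at h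
    exact hw0 (hB w (fun v => h (x := v)) hw)
  obtain ⟨v, hv, hmin⟩ := exists_min_image _ (fun v => x v / -w v) hneg
  simp only [mem_filter, mem_univ, true_and] at hv hmin
  refine ⟨v, by_contra fun h => hv.ne (hwM v h), hv, x + (x v / -w v) • w, ?_, ?_, ?_⟩
  · intro u
    rcases lt_or_ge (w u) 0 with hu | hu
    · have := (le_div_iff₀ (neg_pos.2 hu)).1 (hmin u hu)
      simp only [Pi.zero_apply, Pi.add_apply, Pi.smul_apply, smul_eq_mul]
      linarith
    · exact add_nonneg (hx.nonneg u)
        (mul_nonneg (div_nonneg (hx.nonneg v) (neg_pos.2 hv).le) hu)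
  · rw [Matrix.mulVec_add, Matrix.mulVec_smul, hw, smul_zero, add_zero, hx.mulVec_eq]
  · intro u hu
    rw [mem_erase, not_and_or, not_not] at hu
    rcases hu with rfl | hu
    · have := hv.ne
      simp [div_neg, this]
    · simp [hx.eq_zero_of_notMem u hu, hwM u hu]

variable [Fintype R]

/-- The system `B x = b` is nondegenerate if every nonnegative solution has at least as many
nonzero coordinates as there are rows. -/
def IsNondegenerate (B : Matrix R V ℝ) (b : R → ℝ) : Prop :=
  ∀ F x, IsSolutionOn B b F x → Fintype.card R ≤ #F

open Classical in
/-- The sets with as many columns as there are rows that support a nonnegative solution. -/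
noncomputable def feasibleSupports (B : Matrix R V ℝ) (b : R → ℝ) : Finset (Finset V) :=
  {F | #F = Fintype.card R ∧ ∃ x, IsSolutionOn B b F x}

theorem mem_feasibleSupports :
    F ∈ feasibleSupports B b ↔ #F = Fintype.card R ∧ ∃ x, IsSolutionOn B b F x := by
  simp [feasibleSupports]

theorem IsNondegenerate.pos_of_mem (hb : IsNondegenerate B b) (hx : IsSolutionOn B b F x)
    (hF : #F = Fintype.card R) {v : V} (hv : v ∈ F) : 0 < x v := by
  classical
  refine (hx.nonneg v).lt_of_ne fun h => ?_
  have hle := hb (F.erase v) x ⟨hx.nonneg, hx.mulVec_eq, fun u hu => by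
    rcases eq_or_ne u v with rfl | huv
    exacts [h.symm, hx.eq_zero_of_notMem u fun huF => hu (mem_erase.2 ⟨huv, huF⟩)]⟩
  have hlt := card_erase_lt_of_mem hv
  omega

theorem IsNondegenerate.eq_zero_of_mulVec_eq_zero (hB : ∀ w, 0 ≤ w → B.mulVec w = 0 → w = 0)
    (hb : IsNondegenerate B b) (hx : IsSolutionOn B b F x) (hF : #F = Fintype.card R)
    (hw : B.mulVec w = 0) (hwF : ∀ v ∉ F, w v = 0) : w = 0 := by
  classical
  by_contra hw0
  obtain ⟨v, hv, -, x', hx'⟩ := hx.exists_erase hB hw hw0 hwF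
  have hle := hb _ _ hx'
  have hlt := card_erase_lt_of_mem hv
  omega

variable [DecidableEq V]

theorem IsSolutionOn.exists_ne_isSolutionOn_erase
    (hB : ∀ w, 0 ≤ w → B.mulVec w = 0 → w = 0) (hx : IsSolutionOn B b M x)
    (hM : Fintype.card R < #M) (j : V) :
    ∃ k ∈ M, k ≠ j ∧ ∃ x', IsSolutionOn B b (M.erase k) x' := by
  obtain ⟨w, hw0, hw, hwM, hwj⟩ : ∃ w ≠ 0, B.mulVec w = 0 ∧ (∀ v ∉ M, w v = 0) ∧ 0 ≤ w j := by
    obtain ⟨w, hw0, hw, hwM⟩ := exists_ne_zero_mulVec_eq_zero B hM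
    rcases le_total 0 (w j) with h | h
    · exact ⟨w, hw0, hw, hwM, h⟩
    · exact ⟨-w, neg_ne_zero.2 hw0, by rw [Matrix.mulVec_neg, hw, neg_zero],
        fun v hv => neg_eq_zero.2 (hwM v hv), neg_nonneg.2 h⟩
  obtain ⟨k, hk, hwk, hx'⟩ := hx.exists_erase hB hw hw0 hwM
  exact ⟨k, hk, fun h => hwk.not_ge (h ▸ hwj), hx'⟩

theorem IsNondegenerate.smul_sub_eq_smul_sub
    (hB : ∀ w, 0 ≤ w → B.mulVec w = 0 → w = 0) (hb : IsNondegenerate B b) {j : V}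
    {y z : V → ℝ} (hM : #(M.erase j) = Fintype.card R) (hx : IsSolutionOn B b (M.erase j) x)
    (hy : IsSolutionOn B b M y) (hz : IsSolutionOn B b M z) :
    z j • (y - x) = y j • (z - x) := by
  refine sub_eq_zero.1 (hb.eq_zero_of_mulVec_eq_zero hB hx hM ?_ fun v hv => ?_)
  · simp only [Matrix.mulVec_sub, Matrix.mulVec_smul, hx.mulVec_eq, hy.mulVec_eq, hz.mulVec_eq,
      sub_self, smul_zero]
  · simp only [Pi.sub_apply, Pi.smul_apply, smul_eq_mul, hx.eq_zero_of_notMem v hv]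
    rcases eq_or_ne v j with rfl | hvj
    · ring
    · have hvM : v ∉ M := fun h => hv (mem_erase.2 ⟨hvj, h⟩)
      rw [hy.eq_zero_of_notMem v hvM, hz.eq_zero_of_notMem v hvM]
      ring

theorem IsNondegenerate.eq_or_eq_of_isSolutionOn_erase
    (hB : ∀ w, 0 ≤ w → B.mulVec w = 0 → w = 0) (hb : IsNondegenerate B b)
    (hM : #M = Fintype.card R + 1) {j k l : V} {y z : V → ℝ} (hj : j ∈ M) (hk : k ∈ M)
    (hl : l ∈ M) (hx : IsSolutionOn B b (M.erase j) x) (hy : IsSolutionOn B b (M.erase k) y)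
    (hz : IsSolutionOn B b (M.erase l) z) (hkj : k ≠ j) : l = j ∨ l = k := by
  by_contra! ⟨hlj, hlk⟩
  have hcard : ∀ u ∈ M, #(M.erase u) = Fintype.card R := fun u hu => by
    rw [card_erase_of_mem hu, hM, Nat.add_sub_cancel]
  have hpos : ∀ {u v x'}, u ∈ M → IsSolutionOn B b (M.erase u) x' → v ∈ M → v ≠ u → 0 < x' v :=
    fun hu hx' hv hvu => hb.pos_of_mem hx' (hcard _ hu) (mem_erase.2 ⟨hvu, hv⟩)
  have hyk : y k = 0 := hy.eq_zero_of_notMem k (notMem_erase k M)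
  have hzl : z l = 0 := hz.eq_zero_of_notMem l (notMem_erase l M)
  have hline := hb.smul_sub_eq_smul_sub hB (hcard j hj) hx (hy.mono (erase_subset k M))
    (hz.mono (erase_subset l M))
  have hzy : z j < y j := by
    have hatk : (y j - z j) * x k = y j * z k := by
      have := congrFun hline k
      simp only [Pi.sub_apply, Pi.smul_apply, smul_eq_mul, hyk] at this
      linarith
    refine sub_pos.1 (pos_of_mul_pos_left ?_ (hpos hj hx hk hkj).le)
    exact hatk ▸ mul_pos (hpos hk hy hj hkj.symm) (hpos hl hz hk hlk.symm)
  have hyz : y j < z j := by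
    have hatl : (z j - y j) * x l = z j * y l := by
      have := congrFun hline l
      simp only [Pi.sub_apply, Pi.smul_apply, smul_eq_mul, hzl] at this
      linarith
    refine sub_pos.1 (pos_of_mul_pos_left ?_ (hpos hj hx hl hlj).le)
    exact hatl ▸ mul_pos (hpos hl hz hj hlj.symm) (hpos hk hy hl hlk)
  exact hyz.not_gt hzy

theorem mem_filter_feasibleSupports_subset (hM : #M = Fintype.card R + 1) :
    F ∈ {F ∈ feasibleSupports B b | F ⊆ M} ↔
      ∃ j ∈ M, M.erase j = F ∧ ∃ x, IsSolutionOn B b (M.erase j) x := by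
  rw [mem_filter, mem_feasibleSupports]
  constructor
  · rintro ⟨⟨hF, hx⟩, hFM⟩
    obtain ⟨j, hj, rfl⟩ := exists_eq_insert_iff.2 ⟨hFM, by rw [hF, hM]⟩
    exact ⟨j, mem_insert_self j F, erase_insert hj, (erase_insert hj).symm ▸ hx⟩
  · rintro ⟨j, hj, rfl, hx⟩
    exact ⟨⟨by rw [card_erase_of_mem hj, hM, Nat.add_sub_cancel], hx⟩, erase_subset j M⟩

theorem IsNondegenerate.even_card_filter_feasibleSupports_subset
    (hB : ∀ w, 0 ≤ w → B.mulVec w = 0 → w = 0) (hb : IsNondegenerate B b)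
    (hM : #M = Fintype.card R + 1) : Even #{F ∈ feasibleSupports B b | F ⊆ M} := by
  obtain hempty | ⟨F, hF⟩ := {F ∈ feasibleSupports B b | F ⊆ M}.eq_empty_or_nonempty
  · rw [hempty]
    exact Even.zero
  obtain ⟨j, hj, -, x, hx⟩ := (mem_filter_feasibleSupports_subset hM).1 hF
  obtain ⟨k, hk, hkj, y, hy⟩ := 
    (hx.mono (erase_subset j M)).exists_ne_isSolutionOn_erase hB (by omega) j
  suffices {F ∈ feasibleSupports B b | F ⊆ M} = {M.erase j, M.erase k} by
    rw [this, card_pair fun h => hkj ((erase_inj M hk).1 h.symm)]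
    exact even_two
  ext F
  rw [mem_filter_feasibleSupports_subset hM, mem_insert, mem_singleton]
  constructor
  · rintro ⟨l, hl, rfl, z, hz⟩
    obtain rfl | rfl := hb.eq_or_eq_of_isSolutionOn_erase hB hM hj hk hl hx hy hz hkj
    exacts [Or.inl rfl, Or.inr rfl]
  · rintro (rfl | rfl)
    exacts [⟨j, hj, rfl, x, hx⟩, ⟨k, hk, rfl, y, hy⟩]

end FeasibleSupport

section RightHandSides

open Finset Module

variable {R V : Type*} [Fintype V] {B : Matrix R V ℝ} {b : R → ℝ}

theorem dense_setOf_isNondegenerate [Fintype R] (B : Matrix R V ℝ) :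
    Dense {b | IsNondegenerate B b} := by
  let W : Finset V → Submodule ℝ (R → ℝ) := fun F =>
    (LinearMap.range (B.mulVecLin ∘ₗ Function.ExtendByZero.linearMap ℝ ((↑) : F → V)))
  have hW : ∀ F : Finset V, #F < Fintype.card R → MeasureTheory.volume (W F : Set (R → ℝ)) = 0 :=
    fun F hF => MeasureTheory.Measure.addHaar_submodule _ _ fun htop => by
      have hle := LinearMap.finrank_range_le
        (B.mulVecLin ∘ₗ Function.ExtendByZero.linearMap ℝ ((↑) : F → V))
      rw [show LinearMap.range _ = ⊤ from htop, finrank_top] at hle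
      simp only [finrank_fintype_fun_eq_card, Fintype.card_coe] at hle
      omega
  have hae : ∀ᵐ b : R → ℝ, ∀ F : Finset V, #F < Fintype.card R → b ∉ W F := by
    refine MeasureTheory.ae_all_iff.2 fun F => ?_
    by_cases hF : #F < Fintype.card R
    · simpa [hF] using MeasureTheory.measure_eq_zero_iff_ae_notMem.1 (hW F hF)
    · simp [hF]
  refine (MeasureTheory.Measure.dense_of_ae hae).mono fun b hb F x hx => ?_
  by_contra! hF
  refine hb F hF ⟨fun v => x v, ?_⟩
  rw [LinearMap.comp_apply, Matrix.mulVecLin_apply, ← hx.mulVec_eq]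
  congr 1
  ext v
  by_cases hv : v ∈ F
  · exact Subtype.val_injective.extend_apply (fun u : F => x u) 0 ⟨v, hv⟩
  · rw [hx.eq_zero_of_notMem v hv]
    exact Function.extend_apply' (f := ((↑) : F → V)) (fun u => x u) 0 v (by simpa using hv)

theorem mem_closure_setOf_pos_isNondegenerate [Fintype R] (B : Matrix R V ℝ) (hb : 0 ≤ b) :
    b ∈ closure {b | (∀ i, 0 < b i) ∧ IsNondegenerate B b} := by
  have hopen : IsOpen (Set.univ.pi fun _ : R => Set.Ioi (0 : ℝ)) :=
    isOpen_set_pi Set.finite_univ fun _ _ => isOpen_Ioi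
  have hmem : b ∈ closure (Set.univ.pi fun _ : R => Set.Ioi (0 : ℝ)) := by
    rw [closure_pi_set]
    exact fun i _ => by simpa using hb i
  have hsubset := (dense_setOf_isNondegenerate B).open_subset_closure_inter hopen
  refine closure_mono ?_ (closure_minimal hsubset isClosed_closure hmem)
  exact fun b' hb' => ⟨fun i => hb'.1 i (Set.mem_univ i), hb'.2⟩

theorem IsSolutionOn.le_div {F : Finset V} {x : V → ℝ} (hB : ∀ i v, 0 ≤ B i v)
    (hx : IsSolutionOn B b F x) {i : R} {v : V} (hi : 0 < B i v) : x v ≤ b i / B i v := by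
  rw [le_div_iff₀' hi, ← hx.mulVec_eq]
  exact single_le_sum (f := fun u => B i u * x u) (fun u _ => mul_nonneg (hB i u) (hx.nonneg u))
    (mem_univ v)

theorem isClosed_setOf_exists_isSolutionOn [Finite R] (hB : ∀ i v, 0 ≤ B i v)
    (hcol : ∀ v, ∃ i, 0 < B i v) (F : Finset V) :
    IsClosed {b | ∃ x, IsSolutionOn B b F x} := by
  choose r hr using hcol
  refine isClosed_of_closure_subset fun b hb => ?_
  obtain ⟨β, hβ, hlim⟩ := mem_closure_iff_seq_limit.1 hb
  choose x hx using hβ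
  obtain ⟨C, hC⟩ := hlim.bddAbove_range
  have hbound : ∀ n, x n ∈ Set.Icc (0 : V → ℝ) fun v => C (r v) / B (r v) v := fun n =>
    ⟨(hx n).nonneg, fun v => ((hx n).le_div hB (hr v)).trans <|
      div_le_div_of_nonneg_right (hC (Set.mem_range_self n) (r v)) (hr v).le⟩
  obtain ⟨y, hy, φ, hφ, hlimy⟩ := isCompact_Icc.tendsto_subseq hbound
  refine ⟨y, hy.1, ?_, fun v hv => ?_⟩
  · have hcont : Continuous fun z : V → ℝ => B.mulVec z := by fun_prop
    refine tendsto_nhds_unique ((hcont.tendsto y).comp hlimy) ?_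
    exact (hlim.comp hφ.tendsto_atTop).congr fun n => (hx (φ n)).mulVec_eq.symm
  · refine tendsto_nhds_unique ((continuous_apply v).tendsto y |>.comp hlimy) ?_
    exact tendsto_const_nhds.congr fun n => ((hx (φ n)).eq_zero_of_notMem v hv).symm

end RightHandSides

section ScarfLemma

open Finset

variable {R X L : Type*} [DecidableEq R] {A : Matrix R X ℝ} {b : R → ℝ}

/-- The matrix `A` preceded by the slack columns. -/
def withSlack (A : Matrix R X ℝ) : Matrix R (R ⊕ X) ℝ :=
  Matrix.fromCols 1 A

theorem withSlack_nonneg (hA : ∀ i x, 0 ≤ A i x) (i : R) (v : R ⊕ X) : 0 ≤ withSlack A i v := by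
  rcases v with j | x
  · simp only [withSlack, Matrix.fromCols_apply_inl, Matrix.one_apply]
    split_ifs <;> norm_num
  · exact hA i x

theorem exists_withSlack_pos (hcol : ∀ x, ∃ i, 0 < A i x) (v : R ⊕ X) :
    ∃ i, 0 < withSlack A i v := by
  rcases v with j | x
  · exact ⟨j, by simp [withSlack]⟩
  · exact hcol x

variable [Fintype R] [Fintype X]

theorem withSlack_mulVec (A : Matrix R X ℝ) (x : R ⊕ X → ℝ) :
    (withSlack A).mulVec x = x ∘ Sum.inl + A.mulVec (x ∘ Sum.inr) := by
  rw [withSlack, Matrix.fromCols_mulVec, Matrix.one_mulVec]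

theorem isSolutionOn_slackColumns (A : Matrix R X ℝ) (hb : 0 ≤ b) :
    IsSolutionOn (withSlack A) b (slackColumns R X) (Sum.elim b 0) where
  nonneg := by
    rintro (i | x)
    exacts [hb i, le_rfl]
  mulVec_eq := by simp [withSlack_mulVec]
  eq_zero_of_notMem v hv := by
    rcases v with i | x
    exacts [absurd (inl_mem_slackColumns i) hv, rfl]

variable [LinearOrder L] {c : R → R ⊕ X → L}

theorem IsScarfOrder.exists_isDominating_of_isNondegenerate (hc : IsScarfOrder c)
    (hA : ∀ i x, 0 ≤ A i x) (hcol : ∀ x, ∃ i, 0 < A i x) (hb : 0 ≤ b)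
    (hnd : IsNondegenerate (withSlack A) b) :
    ∃ D, IsDominating c D ∧ ∃ x, IsSolutionOn (withSlack A) b D x := by
  classical
  cases isEmpty_or_nonempty X
  · refine ⟨slackColumns R X, ?_, _, isSolutionOn_slackColumns A hb⟩
    rintro (i | x)
    exacts [⟨i, fun d _ => hc.slack_le i d⟩, isEmptyElim x]
  set 𝒟 := insert (slackColumns R X) (dominatingSets (breakTies c))
  set ℱ := feasibleSupports (withSlack A) b
  have hker : ∀ w, 0 ≤ w → (withSlack A).mulVec w = 0 → w = 0 := fun _ =>
    eq_zero_of_nonneg_of_mulVec_eq_zero (withSlack_nonneg hA) (exists_withSlack_pos hcol)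
  have h𝒟 : (𝒟 : Set (Finset (R ⊕ X))).Sized (Fintype.card R) := fun D hD => by
    rcases mem_insert.1 hD with rfl | hD
    exacts [card_slackColumns, (mem_dominatingSets.1 hD).1]
  have heven : Even #(𝒟 ∩ ℱ) :=
    even_card_inter_of_cycle_of_cocycle h𝒟 (fun F hF => (mem_feasibleSupports.1 hF).1)
      (fun K hK => (isScarfOrder_breakTies hc).even_card_filter_subset_insert_slackColumns
        (injective_breakTies c) hK)
      (fun M hM => hnd.even_card_filter_feasibleSupports_subset hker hM)
      (Sum.inr (Classical.arbitrary X))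
  have hslack : slackColumns R X ∈ 𝒟 ∩ ℱ := mem_inter.2 ⟨mem_insert_self _ _,
    mem_feasibleSupports.2 ⟨card_slackColumns, _, isSolutionOn_slackColumns A hb⟩⟩
  have hcard : 1 < #(𝒟 ∩ ℱ) := Nat.one_lt_of_ne_zero_of_even (card_ne_zero_of_mem hslack) heven
  obtain ⟨D, hD, hne⟩ := exists_mem_ne hcard (slackColumns R X)
  obtain ⟨hD𝒟, hDℱ⟩ := mem_inter.1 hD
  have hdom := (mem_dominatingSets.1 (mem_of_mem_insert_of_ne hD𝒟 hne)).2
  exact ⟨D, hdom.of_breakTies, (mem_feasibleSupports.1 hDℱ).2⟩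

-- For `b i = 0` a solution need not meet row `i`; that some column of `D` does is inherited from
-- nearby positive right-hand sides.
theorem IsScarfOrder.exists_isDominating_isSolutionOn (hc : IsScarfOrder c)
    (hA : ∀ i x, 0 ≤ A i x) (hcol : ∀ x, ∃ i, 0 < A i x) (hb : 0 ≤ b) :
    ∃ D, (IsDominating c D ∧ ∀ i, ∃ v ∈ D, withSlack A i v ≠ 0) ∧
      ∃ x, IsSolutionOn (withSlack A) b D x := by
  let P : Set (Finset (R ⊕ X)) :=
    {D | IsDominating c D ∧ ∀ i, ∃ v ∈ D, withSlack A i v ≠ 0}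
  have hclosed : IsClosed (⋃ D ∈ P, {b | ∃ x, IsSolutionOn (withSlack A) b D x}) :=
    (Set.toFinite P).isClosed_biUnion fun D _ =>
      isClosed_setOf_exists_isSolutionOn (withSlack_nonneg hA) (exists_withSlack_pos hcol) D
  suffices b ∈ ⋃ D ∈ P, {b | ∃ x, IsSolutionOn (withSlack A) b D x} by
    simpa only [Set.mem_iUnion₂, exists_prop, P, Set.mem_ofPred_eq] using this
  refine closure_minimal (fun b' hb' => ?_) hclosed
    (mem_closure_setOf_pos_isNondegenerate (withSlack A) hb)
  obtain ⟨D, hD, x, hx⟩ := hc.exists_isDominating_of_isNondegenerate hA hcol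
    (fun i => (hb'.1 i).le) hb'.2
  exact Set.mem_biUnion (⟨hD, fun i => hx.exists_mem_ne_zero (hb'.1 i).ne'⟩ : D ∈ P) ⟨x, hx⟩

end ScarfLemma

section FractionalStable

variable {R X L : Type*} [LinearOrder L]

/-- Row orders for a hypergraph with preferences: in row `i` the slack column of `i` comes first,
then the incident columns from the worst (greatest key) to the best, then the other proper columns,
then the other slack columns. -/
noncomputable def preferenceOrder (A : Matrix R X ℝ) (key : R → X → L) (i : R) :
    R ⊕ X → WithBot (Lᵒᵈ ⊕ₗ Bool) :=
  open Classical in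
  Sum.elim (fun j => if j = i then ⊥ else ((Sum.inrₗ true : Lᵒᵈ ⊕ₗ Bool) : WithBot (Lᵒᵈ ⊕ₗ Bool)))
    fun x => ((if A i x ≠ 0 then Sum.inlₗ (OrderDual.toDual (key i x)) else Sum.inrₗ false :
      Lᵒᵈ ⊕ₗ Bool) : WithBot (Lᵒᵈ ⊕ₗ Bool))

theorem isScarfOrder_preferenceOrder (A : Matrix R X ℝ) (key : R → X → L) :
    IsScarfOrder (preferenceOrder A key) where
  slack_lt i v hv := by
    rcases v with j | x
    · have hj : j ≠ i := fun h => hv (h ▸ rfl)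
      simp [preferenceOrder, hj]
    · simp only [preferenceOrder, Sum.elim_inl, Sum.elim_inr, if_true]
      split_ifs <;> exact WithBot.bot_lt_coe _
  lt_slack i j x hj := by
    simp only [preferenceOrder, Sum.elim_inl, Sum.elim_inr, if_neg hj]
    split_ifs <;> simp

theorem preferenceOrder_inr_le_inr {A : Matrix R X ℝ} {key : R → X → L} {i : R} {x x' : X}
    (hx' : A i x' ≠ 0)
    (h : preferenceOrder A key i (Sum.inr x) ≤ preferenceOrder A key i (Sum.inr x')) :
    A i x ≠ 0 ∧ key i x' ≤ key i x := by
  by_cases hx : A i x = 0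
  · simp [preferenceOrder, hx, hx'] at h
  · simpa [preferenceOrder, hx, hx', Sum.Lex.inl_le_inl_iff] using h

/-- A fractional solution `y` of `A y ≤ b` is stable if every column `x` is dominated in one of its
rows `i`: the row is tight, and weakly prefers (by smaller keys) all columns in use to `x`. -/
structure IsFractionalStable [Fintype X] (A : Matrix R X ℝ) (b : R → ℝ) (key : R → X → L)
    (y : X → ℝ) : Prop where
  nonneg : 0 ≤ y
  mulVec_le : A.mulVec y ≤ b
  dominated : ∀ x, ∃ i, A i x ≠ 0 ∧ A.mulVec y i = b i ∧
    ∀ x', A i x' ≠ 0 → 0 < y x' → key i x' ≤ key i x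

theorem exists_isFractionalStable [Finite R] [Fintype X] {A : Matrix R X ℝ}
    (hA : ∀ i x, 0 ≤ A i x) (hcol : ∀ x, ∃ i, 0 < A i x) {b : R → ℝ} (hb : 0 ≤ b)
    (key : R → X → L) : ∃ y, IsFractionalStable A b key y := by
  classical
  have := Fintype.ofFinite R
  have hc := isScarfOrder_preferenceOrder A key
  obtain ⟨D, ⟨hD, hrow⟩, y, hy⟩ := hc.exists_isDominating_isSolutionOn hA hcol hb
  have hsum : ∀ i, y (Sum.inl i) + A.mulVec (y ∘ Sum.inr) i = b i := fun i => by
    rw [← hy.mulVec_eq, withSlack_mulVec]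
    rfl
  refine ⟨y ∘ Sum.inr, fun x => hy.nonneg _, fun i => ?_, fun x => ?_⟩
  · exact hsum i ▸ le_add_of_nonneg_left (hy.nonneg (Sum.inl i))
  obtain ⟨i, hi⟩ := hD (Sum.inr x)
  have hslack : Sum.inl i ∉ D := hc.slack_notMem hi
  refine ⟨i, ?_, ?_, fun x' hx' hpos => ?_⟩
  · obtain ⟨j | x', hmem, hne⟩ := hrow i
    · obtain rfl : i = j := by simpa [withSlack, Matrix.one_apply] using hne
      exact absurd hmem hslack
    · exact (preferenceOrder_inr_le_inr (show A i x' ≠ 0 from hne) (hi _ hmem)).1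
  · rw [← hsum i, hy.eq_zero_of_notMem _ hslack, zero_add]
  · have hmem : Sum.inr x' ∈ D := not_imp_comm.1 (hy.eq_zero_of_notMem _) hpos.ne'
    exact (preferenceOrder_inr_le_inr hx' (hi _ hmem)).2

end FractionalStable

theorem exists_eq_append_cons_forall_not {α : Type*} {P : α → Prop} {l : List α}
    (h : ∃ a ∈ l, P a) : ∃ l₁ a l₂, l = l₁ ++ a :: l₂ ∧ P a ∧ ∀ b ∈ l₂, ¬ P b := by
  induction l with
  | nil => simp at h
  | cons a l ih =>
    by_cases hl : ∃ b ∈ l, P b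
    · obtain ⟨l₁, b, l₂, rfl, hb, hl₂⟩ := ih hl
      exact ⟨a :: l₁, b, l₂, rfl, hb, hl₂⟩
    · have ha : P a := (List.or_exists_of_exists_mem_cons h).resolve_right hl
      exact ⟨[], a, l, rfl, ha, fun b hb hPb => hl ⟨b, hb, hPb⟩⟩

namespace TransitNetwork

variable {S Z I : Type*} {N : TransitNetwork S Z}

/-- A rank that increases along every edge, so that the time-expanded graph is acyclic: the time,
and for equal times arrivals before platforms before departures. -/
noncomputable def Node.rank : N.Node → ℝ ×ₗ ℕ
  | .arrival z k => toLex (N.arr z k, 0)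
  | .platform _ t _ => toLex (t, 1)
  | .departure z k => toLex (N.dep z k, 2)

namespace Edge

theorem rank_src_lt_rank_tgt (e : N.Edge) : e.src.rank < e.tgt.rank := by
  rw [Prod.Lex.lt_iff]
  cases e with
  | waiting s t t' h h' hlt hcons => exact Or.inl hlt
  | boarding z k => exact Or.inr ⟨rfl, Nat.one_lt_two⟩
  | driving z k => exact Or.inl (N.dep_lt_arr z k)
  | alighting z k => exact Or.inr ⟨rfl, Nat.zero_lt_one⟩
  | dwelling z k hk => exact (N.arr_le_dep z k hk).lt_or_eq.imp_right fun h => ⟨h, Nat.two_pos⟩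

variable {e : N.Edge} {z : Z} {k : Fin (N.legs z)}

theorem eq_driving_of_src_eq (h : e.src = .departure z k) : e = driving z k := by
  cases e <;> simp only [src, reduceCtorEq, Node.departure.injEq] at h
  obtain ⟨rfl, h⟩ := h
  rw [eq_of_heq h]

theorem eq_driving_of_tgt_eq (h : e.tgt = .arrival z k) : e = driving z k := by
  cases e <;> simp only [tgt, reduceCtorEq, Node.arrival.injEq] at h
  obtain ⟨rfl, h⟩ := h
  rw [eq_of_heq h]

theorem eq_boarding_or_eq_dwelling_of_tgt_eq (h : e.tgt = .departure z k) :
    e = boarding z k ∨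
      ∃ (j : ℕ) (hj : j + 1 < N.legs z), k = ⟨j + 1, hj⟩ ∧ e = dwelling z j hj := by
  cases e <;> simp only [tgt, reduceCtorEq, Node.departure.injEq] at h
  · obtain ⟨rfl, h⟩ := h
    exact Or.inl (by rw [eq_of_heq h])
  · obtain ⟨rfl, h⟩ := h
    exact Or.inr ⟨_, _, (eq_of_heq h).symm, rfl⟩

end Edge

namespace IsWalk

variable {l l₁ l₂ m₁ m₂ : List N.Edge} {e e₁ e₂ : N.Edge} {v v' w w' : N.Node}

theorem append_iff : IsWalk v (l₁ ++ l₂) w ↔ ∃ u, IsWalk v l₁ u ∧ IsWalk u l₂ w := by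
  induction l₁ generalizing v with
  | nil => simp [IsWalk]
  | cons e l ih => simp only [List.cons_append, IsWalk, ih, and_assoc, exists_and_left]

theorem crossover (h₁ : IsWalk v (m₁ ++ e₁ :: m₂) w) (h₂ : IsWalk v' (l₁ ++ e₂ :: l₂) w')
    (h : e₁.src = e₂.tgt) : IsWalk v (m₁ ++ l₂) w' := by
  obtain ⟨u, hu, hsrc, -⟩ := append_iff.1 h₁
  obtain ⟨-, -, -, hl₂⟩ := append_iff.1 h₂
  exact append_iff.2 ⟨u, hu, hsrc ▸ h ▸ hl₂⟩

theorem rank_lt (h : IsWalk v l w) : ∀ u ∈ l.map Edge.tgt, v.rank < u.rank := by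
  induction l generalizing v with
  | nil => simp
  | cons e l ih =>
    have he : v.rank < e.tgt.rank := h.1 ▸ e.rank_src_lt_rank_tgt
    exact List.forall_mem_cons.2 ⟨he, fun u hu => he.trans (ih h.2 u hu)⟩

theorem nodup (h : IsWalk v l w) : (v :: l.map Edge.tgt).Nodup := by
  induction l generalizing v with
  | nil => simp
  | cons e l ih => exact List.nodup_cons.2 ⟨fun hv => (h.rank_lt v hv).false, ih h.2⟩

theorem sum_traversalTime (h : IsWalk v l w) :
    (l.map Edge.traversalTime).sum = w.time - v.time := by
  induction l generalizing v with
  | nil => simp [show v = w from h]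
  | cons e l ih =>
    rw [List.map_cons, List.sum_cons, ih h.2, Edge.traversalTime, h.1]
    ring

theorem exists_tgt_eq_src (h : IsWalk v l w) (he : e ∈ l) (hv : e.src ≠ v) :
    ∃ e' ∈ l, e'.tgt = e.src := by
  induction l generalizing v with
  | nil => simp at he
  | cons a l ih =>
    rcases List.mem_cons.1 he with rfl | he
    · exact absurd h.1 hv
    · by_cases ha : e.src = a.tgt
      · exact ⟨a, List.mem_cons_self, ha.symm⟩
      · exact List.exists_mem_cons_of_exists (ih h.2 he ha)

theorem exists_src_eq_tgt (h : IsWalk v l w) (he : e ∈ l) (hw : e.tgt ≠ w) :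
    ∃ e' ∈ l, e'.src = e.tgt := by
  induction l generalizing v with
  | nil => simp at he
  | cons a l ih =>
    rcases List.mem_cons.1 he with rfl | he
    · cases l with
      | nil => exact absurd h.2 hw
      | cons a' l => exact ⟨a', by simp, h.2.1⟩
    · exact List.exists_mem_cons_of_exists (ih h.2 he)

end IsWalk

theorem Path.traversalTime_eq (p : N.Path) : p.traversalTime = p.finish.time - p.start.time :=
  p.isWalk.sum_traversalTime

theorem CommodityPath.time_start_mem {c : Commodity S} (p : N.CommodityPath c) :
    p.1.start.time ∈ c.departureTimes := by
  obtain ⟨t, _, hstart, ht⟩ := p.2.1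
  rwa [hstart]

namespace Strategy

variable {c : Commodity S} {x p q : N.Strategy c} {z : Z} {k : Fin (N.legs z)}

theorem cost_some_eq_of_finish_eq {θ : ℝ} (hc : c.departureTimes = {θ})
    {p q : N.CommodityPath c} (h : p.1.finish = q.1.finish) :
    cost (some p) = cost (some q) := by
  have htime : ∀ r : N.CommodityPath c, r.1.start.time = θ := fun r =>
    Set.mem_singleton_iff.1 (hc.subset r.time_start_mem)
  simp only [cost, Path.traversalTime_eq, Path.arrivalTime, htime, h]

theorem driving_mem_of_boarding_mem (h : .boarding z k ∈ x.edges) : .driving z k ∈ x.edges := by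
  rcases x with _ | ⟨p, _, t, ht, hfinish⟩
  · simp [edges] at h
  · obtain ⟨e, he, hsrc⟩ := p.isWalk.exists_src_eq_tgt h (by simp [hfinish, Edge.tgt])
    exact Edge.eq_driving_of_src_eq hsrc ▸ he

theorem boarding_mem_or_driving_mem_of_driving_mem (h : .driving z k ∈ x.edges) :
    .boarding z k ∈ x.edges ∨ ∃ (j : ℕ) (hj : j + 1 < N.legs z), k = ⟨j + 1, hj⟩ ∧
      .driving z ⟨j, Nat.lt_of_succ_lt hj⟩ ∈ x.edges := by
  rcases x with _ | ⟨p, ⟨t, ht, hstart, _⟩, _⟩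
  · simp [edges] at h
  · obtain ⟨e, he, htgt⟩ := p.isWalk.exists_tgt_eq_src h (by simp [hstart, Edge.src])
    rcases Edge.eq_boarding_or_eq_dwelling_of_tgt_eq htgt with rfl | ⟨j, hj, hk, rfl⟩
    · exact Or.inl he
    · obtain ⟨e', he', htgt'⟩ := p.isWalk.exists_tgt_eq_src he (by simp [hstart, Edge.src])
      exact Or.inr ⟨j, hj, hk, Edge.eq_driving_of_tgt_eq htgt' ▸ he'⟩

open Classical in
/-- The last stop up to stop `k` at which a strategy boards the vehicle `z`; `0` if it does not
board `z` up to stop `k`. -/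
noncomputable def boardingIndex (x : N.Strategy c) (z : Z) (k : ℕ) : ℕ :=
  Nat.findGreatest (fun j => ∃ hj : j < N.legs z, .boarding z ⟨j, hj⟩ ∈ x.edges) k

theorem boardingIndex_le (x : N.Strategy c) (z : Z) (k : ℕ) : x.boardingIndex z k ≤ k := by
  classical exact Nat.findGreatest_le k

theorem le_boardingIndex {j : Fin (N.legs z)} {k : ℕ} (hjk : j ≤ k)
    (h : .boarding z j ∈ x.edges) : j ≤ x.boardingIndex z k := by
  classical exact Nat.le_findGreatest hjk ⟨j.2, h⟩

theorem driving_mem_of_boardingIndex_le (h : .driving z k ∈ x.edges) {m : Fin (N.legs z)}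
    (hm : x.boardingIndex z k ≤ m) (hmk : m ≤ k) : .driving z m ∈ x.edges := by
  obtain ⟨m, hm'⟩ := m
  refine Nat.decreasingInduction'
    (P := fun m => ∀ hm : m < N.legs z, .driving z ⟨m, hm⟩ ∈ x.edges)
    (fun n hnk hmn ih hn => ?_) hmk (fun _ => h) hm'
  have hn' : n + 1 < N.legs z := lt_of_le_of_lt hnk k.2
  rcases boarding_mem_or_driving_mem_of_driving_mem (ih hn') with hb | ⟨j, _, hj, hd⟩
  · exact absurd ((le_boardingIndex hnk hb).trans (hm.trans hmn)) n.lt_irrefl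
  · obtain rfl : n = j := by simpa using hj
    exact hd

theorem exists_boarding_boardingIndex_mem (h : .driving z k ∈ x.edges) :
    ∃ hj : x.boardingIndex z k < N.legs z, .boarding z ⟨_, hj⟩ ∈ x.edges := by
  classical
  rcases eq_or_ne (x.boardingIndex z k) 0 with h0 | h0
  · have hpos : 0 < N.legs z := k.pos
    have hd : .driving z ⟨0, hpos⟩ ∈ x.edges :=
      driving_mem_of_boardingIndex_le h h0.le (Nat.zero_le _)
    simp only [h0]
    exact ⟨hpos, (boarding_mem_or_driving_mem_of_driving_mem hd).resolve_right (by simp)⟩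
  · exact Nat.findGreatest_of_ne_zero rfl h0

theorem exists_crossover {θ : ℝ} (hc : c.departureTimes = {θ}) {e₁ e₂ : N.Edge}
    {m₁ m₂ l₁ l₂ : List N.Edge} (hp : p.edges = m₁ ++ e₁ :: m₂) (hq : q.edges = l₁ ++ e₂ :: l₂)
    (h : e₁.src = e₂.tgt) : ∃ r : N.Strategy c, r.edges = m₁ ++ l₂ ∧ r.cost = q.cost := by
  rcases p with _ | ⟨p, hstart, _⟩
  · simp [edges] at hp
  rcases q with _ | ⟨q, _, hfinish⟩
  · simp [edges] at hq
  replace hp : p.edges = m₁ ++ e₁ :: m₂ := hp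
  replace hq : q.edges = l₁ ++ e₂ :: l₂ := hq
  have hwalk : IsWalk p.start (m₁ ++ l₂) q.finish :=
    IsWalk.crossover (hp ▸ p.isWalk) (hq ▸ q.isWalk) h
  exact ⟨some ⟨⟨p.start, q.finish, m₁ ++ l₂, hwalk, hwalk.nodup⟩, hstart, hfinish⟩, rfl,
    cost_some_eq_of_finish_eq hc rfl⟩

theorem exists_splice {θ : ℝ} (hc : c.departureTimes = {θ}) (p q : N.Strategy c) :
    ∃ r : N.Strategy c, r.cost = q.cost ∧
      ∀ (z : Z) (k : Fin (N.legs z)), .boarding z k ∈ r.edges →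
        .boarding z k ∈ p.edges ∨ .boarding z k ∈ q.edges ∧ .driving z k ∉ p.edges := by
  let IsShared (e : N.Edge) : Prop := ∃ z k, e = .boarding z k ∧ .driving z k ∈ p.edges
  by_cases h : ∃ e ∈ q.edges, IsShared e
  · obtain ⟨l₁, _, l₂, hq, ⟨z, k, rfl, hdrive⟩, hlast⟩ := exists_eq_append_cons_forall_not h
    obtain ⟨m₁, m₂, hp⟩ := List.append_of_mem hdrive
    obtain ⟨r, hr, hcost⟩ := exists_crossover hc hp hq rfl
    refine ⟨r, hcost, fun z' k' hboard => ?_⟩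
    rcases List.mem_append.1 (hr ▸ hboard) with hmem | hmem
    · exact Or.inl (hp ▸ List.mem_append_left _ hmem)
    · exact Or.inr ⟨hq ▸ List.mem_append_right _ (List.mem_cons_of_mem _ hmem),
        fun hd => hlast _ hmem ⟨z', k', rfl, hd⟩⟩
  · exact ⟨q, rfl, fun z k hboard => Or.inr ⟨hboard, fun hd => h ⟨_, hboard, z, k, rfl, hd⟩⟩⟩

/-- The preferences of leg `k` of the trip `z`: earlier boarding first, then lower cost. -/
noncomputable def legKey (x : N.Strategy c) (z : Z) (k : ℕ) : ℕ ×ₗ ℝ :=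
  toLex (x.boardingIndex z k, x.cost)

end Strategy

namespace FlowVector

variable {C : I → Commodity S} {f : N.FlowVector C} {e e' : N.Edge}

open Classical in
theorem ite_mem_edges_le_ite_mem_edges (h0 : ∀ i p, 0 ≤ f i p)
    (h : ∀ i p, 0 < f i p → e ∈ p.edges → e' ∈ p.edges) (i : I) (p : N.Strategy (C i)) :
    (if e ∈ p.edges then f i p else 0) ≤ if e' ∈ p.edges then f i p else 0 := by
  rcases (h0 i p).eq_or_lt with hzero | hpos
  · simp [← hzero]
  · split_ifs with he he'
    exacts [le_rfl, absurd (h i p hpos he) he', hpos.le, le_rfl]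

variable [Fintype I] [Finite Z]

open Classical in
theorem edgeFlow_single (i : I) (r : N.Strategy (C i)) (e : N.Edge) :
    edgeFlow (Pi.single i (Pi.single r 1) : N.FlowVector C) e = if e ∈ r.edges then 1 else 0 := by
  rw [edgeFlow, Fintype.sum_eq_single i, Fintype.sum_eq_single r]
  · simp
  · intro s hs
    simp [Pi.single_eq_of_ne hs]
  · intro j hj
    exact Finset.sum_eq_zero fun s _ => by simp [Pi.single_eq_of_ne hj]

open Classical in
theorem edgeFlow_deviate (f : N.FlowVector C) (i : I) (p q : N.Strategy (C i)) (ε : ℝ)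
    (e : N.Edge) : (f.deviate i p q ε).edgeFlow e =
      f.edgeFlow e + ε * ((if e ∈ q.edges then 1 else 0) - if e ∈ p.edges then 1 else 0) := by
  rw [← edgeFlow_single i p, ← edgeFlow_single i q]
  simp only [edgeFlow, deviate, ← Finset.sum_sub_distrib, Finset.mul_sum, ← Finset.sum_add_distrib]
  refine Finset.sum_congr rfl fun j _ => Finset.sum_congr rfl fun s _ => ?_
  split_ifs <;> simp

theorem edgeFlow_lt_of_mem_availableAlternatives {i : I} {p q : N.Strategy (C i)}
    (h : q ∈ f.availableAlternatives i p) {z : Z} {k : Fin (N.legs z)}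
    (hq : .boarding z k ∈ q.edges) (hp : .driving z k ∉ p.edges) :
    f.edgeFlow (.driving z k) < N.capacity z := by
  obtain ⟨ε, hε, -, hadm⟩ := h
  have hle := hadm z k hq
  rw [edgeFlow_deviate, if_pos (Strategy.driving_mem_of_boarding_mem hq), if_neg hp] at hle
  linarith

theorem edgeFlow_le_edgeFlow (h0 : ∀ i p, 0 ≤ f i p)
    (h : ∀ i p, 0 < f i p → e ∈ p.edges → e' ∈ p.edges) : f.edgeFlow e ≤ f.edgeFlow e' :=
  Finset.sum_le_sum fun i _ => Finset.sum_le_sum fun p _ => ite_mem_edges_le_ite_mem_edges h0 h i p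

theorem mem_edges_of_edgeFlow_eq (h0 : ∀ i p, 0 ≤ f i p)
    (h : ∀ i p, 0 < f i p → e ∈ p.edges → e' ∈ p.edges) (heq : f.edgeFlow e = f.edgeFlow e')
    {i : I} {p : N.Strategy (C i)} (hpos : 0 < f i p) (he' : e' ∈ p.edges) : e ∈ p.edges := by
  classical
  have hle := ite_mem_edges_le_ite_mem_edges h0 h
  have hsum := (Finset.sum_eq_sum_iff_of_le fun i _ => Finset.sum_le_sum fun p _ => hle i p).1 heq
    i (Finset.mem_univ i)
  have hp := (Finset.sum_eq_sum_iff_of_le fun p _ => hle i p).1 hsum p (Finset.mem_univ p)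
  by_contra he
  rw [if_neg he, if_pos he'] at hp
  exact hpos.ne hp

section Boarding

variable {z : Z} {j k : Fin (N.legs z)}

theorem Feasible.edgeFlow_eq_capacity_of_boardingIndex_le (hf : f.Feasible) (hjk : j ≤ k)
    (hfull : f.edgeFlow (.driving z k) = N.capacity z)
    (h : ∀ i p, 0 < f i p → .driving z k ∈ p.edges → p.boardingIndex z k ≤ j) :
    f.edgeFlow (.driving z j) = N.capacity z :=
  (hf.2 z j).antisymm <| hfull ▸ edgeFlow_le_edgeFlow hf.1.1 fun i p hpos hp =>
    Strategy.driving_mem_of_boardingIndex_le hp (h i p hpos hp) hjk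

theorem Feasible.driving_mem_of_boardingIndex_le (hf : f.Feasible) (hjk : j ≤ k)
    (hfull : f.edgeFlow (.driving z k) = N.capacity z)
    (h : ∀ i p, 0 < f i p → .driving z k ∈ p.edges → p.boardingIndex z k ≤ j)
    {i : I} {p : N.Strategy (C i)} (hpos : 0 < f i p) (hp : .driving z j ∈ p.edges) :
    .driving z k ∈ p.edges :=
  mem_edges_of_edgeFlow_eq hf.1.1 (fun i p hpos hp =>
      Strategy.driving_mem_of_boardingIndex_le hp (h i p hpos hp) hjk)
    (hfull.trans (hf.edgeFlow_eq_capacity_of_boardingIndex_le hjk hfull h).symm) hpos hp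

end Boarding

/-- The strategy `q` is dominated by its commodity `i`: no strategy of `i` in use costs more. -/
def IsDominatedByCommodity (f : N.FlowVector C) (i : I) (q : N.Strategy (C i)) : Prop :=
  ∀ p, 0 < f i p → p.cost ≤ q.cost

/-- The strategy `q` is dominated at leg `k` of the trip `z`, which it drives: the leg is full and
weakly prefers all its passengers to `q`. -/
structure IsDominatedAtLeg (f : N.FlowVector C) {c : Commodity S} (q : N.Strategy c) (z : Z)
    (k : Fin (N.legs z)) : Prop where
  driving_mem : .driving z k ∈ q.edges
  edgeFlow_eq : f.edgeFlow (.driving z k) = N.capacity z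
  legKey_le : ∀ i p, 0 < f i p → .driving z k ∈ p.edges → p.legKey z k ≤ q.legKey z k

/-- A stable flow: a feasible flow in which every strategy is dominated by its commodity or at a
leg. -/
structure IsStable (f : N.FlowVector C) : Prop where
  feasible : f.Feasible
  dominated : ∀ i (q : N.Strategy (C i)),
    f.IsDominatedByCommodity i q ∨ ∃ z k, f.IsDominatedAtLeg q z k

open Classical in
/-- The rows are the commodities and the legs, the columns are the strategies; the entry is `1` if
the strategy belongs to the commodity or drives the leg, respectively. -/
noncomputable def incidenceMatrix (N : TransitNetwork S Z) (C : I → Commodity S) :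
    Matrix (I ⊕ (z : Z) × Fin (N.legs z)) ((i : I) × N.Strategy (C i)) ℝ :=
  Matrix.fromRows (.of fun i x => if x.1 = i then 1 else 0)
    (.of fun l x => if .driving l.1 l.2 ∈ x.2.edges then 1 else 0)

theorem incidenceMatrix_mulVec_inl (y : (i : I) × N.Strategy (C i) → ℝ) (i : I) :
    (incidenceMatrix N C).mulVec y (.inl i) = ∑ p, Sigma.curry y i p := by
  simp only [incidenceMatrix, Matrix.mulVec, dotProduct, Matrix.fromRows_apply_inl, Matrix.of_apply,
    ite_mul, one_mul, zero_mul, Fintype.sum_sigma, Sigma.curry]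
  rw [Fintype.sum_eq_single i fun j hj => by simp [hj]]
  simp

theorem incidenceMatrix_mulVec_inr (y : (i : I) × N.Strategy (C i) → ℝ) (z : Z)
    (k : Fin (N.legs z)) :
    (incidenceMatrix N C).mulVec y (.inr ⟨z, k⟩) =
      edgeFlow (Sigma.curry y : N.FlowVector C) (.driving z k) := by
  simp only [incidenceMatrix, Matrix.mulVec, dotProduct, Matrix.fromRows_apply_inr, Matrix.of_apply,
    ite_mul, one_mul, zero_mul, Fintype.sum_sigma, edgeFlow, Sigma.curry]

/-- The demands of the commodities and the capacities of the legs. -/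
def supply (N : TransitNetwork S Z) (C : I → Commodity S) : I ⊕ (z : Z) × Fin (N.legs z) → ℝ :=
  Sum.elim (fun i => (C i).demand) fun l => N.capacity l.1

/-- The preferences of the commodities (lower cost) and of the legs (`Strategy.legKey`). -/
noncomputable def preferenceKey (N : TransitNetwork S Z) (C : I → Commodity S) :
    I ⊕ (z : Z) × Fin (N.legs z) → (i : I) × N.Strategy (C i) → ℕ ×ₗ ℝ :=
  Sum.elim (fun _ x => toLex (0, x.2.cost)) fun l x => x.2.legKey l.1 l.2

theorem isStable_of_isFractionalStable {y : (i : I) × N.Strategy (C i) → ℝ}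
    (hy : IsFractionalStable (incidenceMatrix N C) (supply N C) (preferenceKey N C) y) :
    IsStable (Sigma.curry y : N.FlowVector C) where
  feasible := by
    refine ⟨⟨fun i p => hy.nonneg _, fun i => ?_⟩, fun z k => ?_⟩
    · obtain ⟨j | ⟨z, k⟩, hne, htight, -⟩ := hy.dominated ⟨i, none⟩
      · obtain rfl : i = j := by simpa [incidenceMatrix] using hne
        exact (incidenceMatrix_mulVec_inl y i).symm.trans htight
      · simp [incidenceMatrix, Strategy.edges] at hne
    · exact (incidenceMatrix_mulVec_inr y z k).symm.trans_le (hy.mulVec_le _)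
  dominated i q := by
    obtain ⟨j | ⟨z, k⟩, hne, htight, hpref⟩ := hy.dominated ⟨i, q⟩
    · obtain rfl : i = j := by simpa [incidenceMatrix] using hne
      refine Or.inl fun p hp => ?_
      simpa [preferenceKey, Prod.Lex.toLex_le_toLex] using
        hpref ⟨i, p⟩ (by simp [incidenceMatrix]) hp
    · refine Or.inr ⟨z, k, by simpa [incidenceMatrix] using hne,
        (incidenceMatrix_mulVec_inr y z k).symm.trans htight, fun i p hpos hp => ?_⟩
      exact hpref ⟨i, p⟩ (by simpa [incidenceMatrix] using hp) hpos

theorem exists_isStable (N : TransitNetwork S Z) (C : I → Commodity S) :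
    ∃ f : N.FlowVector C, f.IsStable := by
  obtain ⟨y, hy⟩ := exists_isFractionalStable (A := incidenceMatrix N C) (b := supply N C)
    (hA := by
      rintro (i | l) x <;> simp only [incidenceMatrix, Matrix.fromRows_apply_inl,
        Matrix.fromRows_apply_inr, Matrix.of_apply] <;> split_ifs <;> norm_num)
    (hcol := fun x => ⟨.inl x.1, by simp [incidenceMatrix]⟩)
    (hb := by
      rintro (i | l)
      exacts [(C i).demand_nonneg, N.capacity_nonneg l.1])
    (key := preferenceKey N C)
  exact ⟨_, isStable_of_isFractionalStable hy⟩

theorem IsDominatedAtLeg.boardingIndex_le {c : Commodity S} {q : N.Strategy c} {z : Z}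
    {k : Fin (N.legs z)} (hq : f.IsDominatedAtLeg q z k) {i : I} {p : N.Strategy (C i)}
    (hpos : 0 < f i p) (hp : .driving z k ∈ p.edges) :
    p.boardingIndex z k ≤ q.boardingIndex z k :=
  Prod.Lex.monotone_fst _ _ (hq.legKey_le i p hpos hp)

theorem IsDominatedAtLeg.cost_le {c : Commodity S} {q : N.Strategy c} {z : Z}
    {k : Fin (N.legs z)} (hq : f.IsDominatedAtLeg q z k) {i : I} {p : N.Strategy (C i)}
    (hpos : 0 < f i p) (hp : .driving z k ∈ p.edges)
    (hle : q.boardingIndex z k ≤ p.boardingIndex z k) : p.cost ≤ q.cost :=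
  ((Prod.Lex.toLex_le_toLex.1 (hq.legKey_le i p hpos hp)).resolve_left hle.not_gt).2

theorem IsStable.isUserEquilibrium (hf : f.IsStable) (hC : FixedDepartureTimes C) :
    f.IsUserEquilibrium := by
  refine ⟨hf.feasible, fun i p hp q hq => ?_⟩
  obtain ⟨θ, hθ⟩ := hC i
  obtain ⟨r, hcost, hboard⟩ := Strategy.exists_splice hθ p q
  rw [← hcost]
  rcases hf.dominated i r with hdom | ⟨z, k, hdom⟩
  · exact hdom p hp
  obtain ⟨hj, hjr⟩ := Strategy.exists_boarding_boardingIndex_mem hdom.driving_mem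
  set j : Fin (N.legs z) := ⟨r.boardingIndex z k, hj⟩
  have hjk : j ≤ k := r.boardingIndex_le z k
  have hearlier := fun i (p : N.Strategy (C i)) => hdom.boardingIndex_le (p := p)
  rcases hboard z j hjr with hjp | ⟨hjq, hjp⟩
  · have hpk : .driving z k ∈ p.edges := hf.feasible.driving_mem_of_boardingIndex_le hjk
      hdom.edgeFlow_eq hearlier hp (Strategy.driving_mem_of_boarding_mem hjp)
    exact hdom.cost_le hp hpk (Strategy.le_boardingIndex hjk hjp)
  · have hfull : f.edgeFlow (.driving z j) = N.capacity z :=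
      hf.feasible.edgeFlow_eq_capacity_of_boardingIndex_le hjk hdom.edgeFlow_eq hearlier
    exact absurd hfull (edgeFlow_lt_of_mem_availableAlternatives hq hjq hjp).ne

end FlowVector

end TransitNetwork

theorem theorem13 {S Z I : Type*} [Finite Z] [Fintype I] (N : TransitNetwork S Z)
    (C : I → TransitNetwork.Commodity S) (hC : TransitNetwork.FixedDepartureTimes C) :
    ∃ f : N.FlowVector C, f.IsUserEquilibrium := by
  obtain ⟨f, hf⟩ := TransitNetwork.FlowVector.exists_isStable N C
  exact ⟨f, hf.isUserEquilibrium hC⟩
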